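/- **Setting.** Let $\mathbb V$ be a finite-dimensional Euclidean Jordan algebra: a finite-dimensional real inner-product space with a bilinear commutative product $\circ$ and an identity element $e$ such that $x^2\circ(x\circ y)=x\circ(x^2\circ y)$ and $\langle x,y\circ z\rangle=\langle x\circ y,z\rangle$ (for instance $\langle x,y\rangle=\operatorname{tr}(x\circ y)$). Let $\mathcal K_1=\{x\circ x:x\in\mathbb V\}$ be its cone of squares, and for $x\in\operatorname{int}\mathcal K_1$ let $\ln x=\sum_i\ln(\lambda_i)q_i$, where $x=\sum_i\lambda_i q_i$ is a spectral decomposition ($q_i$ orthogonal idempotents with $\sum_i q_i=e$). Assume $\mathbb V$ is representable: it is isomorphic to a Jordan subalgebra of $\mathbb S=\{x\in\mathbb A:x'=x\}$ with product $(xy+yx)/2$, where $\mathbb A$ is a finite-dimensional unital associative real algebra with a linear conjugation $x\mapsto x'$ ($x''=x$, $(xy)'=y'x'$), $\operatorname{tr}(xx')\ge 0$ for all $x\in\mathbb A$ (trace of left multiplication), and $\mathbb S$ is a Euclidean Jordan algebra, i.e. it admits an inner product as above. Let $\mathsf A:\mathbb V\to\mathbb R^m$ be linear with $\mathsf A(\operatorname{int}\mathcal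 K_1)\subseteq\mathbb R^m_{++}$ and $\mathsf A^*(\mathbb R^m_{++})\subseteq\operatorname{int}\mathcal K_1$, let $F(x)=f(\mathsf Ax)$, and let $\phi_u(x)=\langle\ln\nabla F(x),u\rangle$. Let $\mathcal C=\{x\in\mathcal K_1:\langle e,x\rangle=1\}$. We call $F$ *gradient log-convex* if $F$ is differentiable on $\operatorname{int}\mathcal K_1$ with $\nabla F(x)\in\operatorname{int}\mathcal K_1$ there, and $$\lambda\ln\nabla F(x)+(1-\lambda)\ln\nabla F(y)-\ln\nabla F(\lambda x+(1-\lambda)y)\in\mathcal K_1\qquad\text{for all }x,y\in\operatorname{ri}\mathcal C,\ \lambda\in[0,1].$$ **Proposition.** Suppose that either 1. $f(y)=\sum_{j=1}^m w_j\ln y_j$ with $w_j>0$ and $\sum_j w_j=1$, or 2. $f(y)=p^{-1}\ln\big(\sum_{j=1}^m y_j^p\big)$ with $0<p<1$. Then $\phi_u$ is convex on $\operatorname{int}\mathcal K_1$ for every $u\in\mathcal K_1$, and $F$ is gradient log-convex. In particular, both conclusions hold for the following two objectives. * **Quantum state tomography.** $\mathcal K_1$ is the cone of complex Hermitian positive semidefinite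 $n\times n$ matrices, with product $X\circ Y=(XY+YX)/2$ and $\langle X,Y\rangle=\operatorname{tr}(XY)$, and $F(X)=N^{-1}\sum_{j=1}^m n_j\ln\langle X,a_ja_j^H\rangle$ with $a_j\in\mathbb C^n$, counts $n_j\in\mathbb Z_{\ge0}$, $N=\sum_j n_j$, where $a_j\ne0$ whenever $n_j>0$ and $\sum_{j:n_j>0}a_ja_j^H$ is positive definite (this last condition is automatic if $\sum_j a_ja_j^H=I$ and all $n_j>0$). * **Semidefinite relaxation of the Boolean quadratic program.** $\mathcal K_1$ is the cone of real symmetric positive semidefinite $n\times n$ matrices, with the same product and inner product, and $F(X)=2\ln\big(\sum_{i=1}^n\langle X,a_ia_i^\top\rangle^{1/2}\big)$, where $a_i$ is the $i$-th column of $Q^{1/2}$ for a symmetric positive definite $Q$. -/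

import Mathlib

open scoped ComplexOrder

noncomputable section

namespace EJA

/-- A (unital) Jordan algebra structure on a real vector space: a bilinear commutative product
`x ∘ y` with `x² ∘ (x ∘ y) = x ∘ (x² ∘ y)` and an identity element `e`. -/
class JordanAlgebra (V : Type*) [AddCommGroup V] [Module ℝ V] where
  /-- the Jordan product -/
  jmul : V →ₗ[ℝ] V →ₗ[ℝ] V
  /-- the identity element -/
  e : V
  jmul_comm : ∀ x y : V, jmul x y = jmul y x
  jordan : ∀ x y : V, jmul (jmul x x) (jmul x y) = jmul x (jmul (jmul x x) y)
  e_jmul : ∀ x : V, jmul e x = x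

open JordanAlgebra

section Algebra

variable {V : Type*} [AddCommGroup V] [Module ℝ V] [JordanAlgebra V]

/-- A Jordan algebra is Euclidean if it carries some inner product `B` (a symmetric positive
definite bilinear form) with `B(x, y ∘ z) = B(x ∘ y, z)`. -/
def IsEuclidean (V : Type*) [AddCommGroup V] [Module ℝ V] [JordanAlgebra V] : Prop :=
  ∃ B : V →ₗ[ℝ] V →ₗ[ℝ] ℝ,
    (∀ x y, B x y = B y x) ∧ (∀ x, x ≠ 0 → 0 < B x x) ∧
      ∀ x y z, B x (jmul y z) = B (jmul x y) z

variable (V) in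
/-- The cone of squares `{x² : x ∈ V}`. -/
def coneOfSquares : Set V := {x | ∃ y : V, x = jmul y y}

/-- `x = ∑ i, μ i • q i` with `q` a complete system of orthogonal idempotents. -/
structure IsSpectralDecomposition {k : ℕ} (x : V) (μ : Fin k → ℝ) (q : Fin k → V) : Prop where
  idem : ∀ i, jmul (q i) (q i) = q i
  orth : ∀ i j, i ≠ j → jmul (q i) (q j) = 0
  complete : ∑ i, q i = e
  eq_sum : x = ∑ i, μ i • q i

/-- `y` is `∑ i, f (μ i) • q i` for some spectral decomposition `x = ∑ i, μ i • q i`.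
Splitting the idempotents further into primitive ones does not change this sum, so the
idempotents are not required to be primitive. -/
def IsSpectralValue (f : ℝ → ℝ) (x y : V) : Prop :=
  ∃ (k : ℕ) (μ : Fin k → ℝ) (q : Fin k → V),
    IsSpectralDecomposition x μ q ∧ y = ∑ i, f (μ i) • q i

/-- The powers `x⁰ = e`, `x^(n+1) = x ∘ x^n`. -/
def jpow (x : V) : ℕ → V
  | 0 => e
  | n + 1 => jmul x (jpow x n)

theorem IsSpectralDecomposition.jpow_eq {k : ℕ} {x : V} {μ : Fin k → ℝ} {q : Fin k → V}
    (h : IsSpectralDecomposition x μ q) (n : ℕ) : jpow x n = ∑ i, (μ i ^ n) • q i := by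
  induction n with
  | zero => simp [jpow, h.complete]
  | succ n ih =>
    rw [jpow, ih]
    conv_lhs => rw [h.eq_sum]
    simp only [map_sum, LinearMap.sum_apply, map_smul, LinearMap.smul_apply]
    refine Finset.sum_congr rfl fun i _ => ?_
    rw [Finset.sum_eq_single i]
    · rw [h.idem, smul_smul, pow_succ]
    · intro j _ hj
      rw [h.orth j i hj, smul_zero]
    · simp

/-- The value of the functional calculus does not depend on the spectral decomposition. -/
theorem IsSpectralValue.unique {f : ℝ → ℝ} {x y z : V}
    (hy : IsSpectralValue f x y) (hz : IsSpectralValue f x z) : y = z := by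
  classical
  obtain ⟨k, μ, q, h, rfl⟩ := hy
  obtain ⟨l, ν, r, h', rfl⟩ := hz
  let s : Finset ℝ := Finset.univ.image μ ∪ Finset.univ.image ν
  let p : Polynomial ℝ := Lagrange.interpolate s id f
  have hp : ∀ t ∈ s, p.eval t = f t := fun t ht =>
    Lagrange.eval_interpolate_at_node f Function.injective_id.injOn ht
  have key : ∀ {k : ℕ} {μ : Fin k → ℝ} {q : Fin k → V}, IsSpectralDecomposition x μ q →
      (∀ i, μ i ∈ s) → ∑ i, f (μ i) • q i = p.sum fun n c => c • jpow x n := by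
    intro k μ q h hs
    simp only [Polynomial.sum, h.jpow_eq, Finset.smul_sum]
    rw [Finset.sum_comm]
    refine Finset.sum_congr rfl fun i _ => ?_
    rw [← hp _ (hs i), Polynomial.eval_eq_sum, Polynomial.sum, Finset.sum_smul]
    exact Finset.sum_congr rfl fun n _ => by rw [smul_smul]
  rw [key h fun i => by simp [s], key h' fun i => by simp [s]]

open Classical in
/-- The functional calculus `f(x) = ∑ i, f (μ i) • q i`, where `x = ∑ i, μ i • q i` is any
spectral decomposition (and `0` if there were none). -/
def spectralMap (f : ℝ → ℝ) (x : V) : V :=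
  if h : ∃ y, IsSpectralValue f x y then h.choose else 0

theorem IsSpectralValue.spectralMap_eq {f : ℝ → ℝ} {x y : V} (h : IsSpectralValue f x y) :
    spectralMap f x = y := by
  have h' : ∃ y, IsSpectralValue f x y := ⟨y, h⟩
  rw [spectralMap, dif_pos h']
  exact h'.choose_spec.unique h

/-- The logarithm of an element of the interior of the cone of squares. -/
def ln (x : V) : V := spectralMap Real.log x

end Algebra

section Symmetric

variable (A : Type*) [Ring A] [Algebra ℝ A] [StarRing A] [StarModule ℝ A]

/-- The subspace of symmetric elements `x' = x` of an associative real algebra with conjugation. -/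
abbrev Sym : Type _ := selfAdjoint.submodule ℝ A

variable {A} in
theorem half_anticomm_mem (x y : Sym A) :
    (2⁻¹ : ℝ) • ((x : A) * y + y * x) ∈ selfAdjoint.submodule ℝ A := by
  have hx : star (x : A) = x := x.2
  have hy : star (y : A) = y := y.2
  change star ((2⁻¹ : ℝ) • ((x : A) * y + y * x)) = _
  rw [star_smul, star_add, star_mul, star_mul, hx, hy, add_comm]
  simp

/-- The symmetric elements with `x ∘ y = (xy + yx)/2`. -/
instance : JordanAlgebra (Sym A) where
  jmul := LinearMap.mk₂ ℝ (fun x y => ⟨(2⁻¹ : ℝ) • ((x : A) * y + y * x), half_anticomm_mem x y⟩)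
    (by intro x y z; ext; simp [add_mul, mul_add]; module)
    (by intro c x y; ext; simp [smul_comm c])
    (by intro x y z; ext; simp [add_mul, mul_add]; module)
    (by intro c x y; ext; simp [smul_comm c])
  e := ⟨1, star_one A⟩
  jmul_comm := by intro x y; ext; simp [add_comm]
  jordan := by
    intro x y; ext
    simp only [LinearMap.mk₂_apply, smul_add, mul_add, add_mul, smul_mul_assoc, mul_smul_comm,
      mul_assoc]
    module
  e_jmul := by
    intro x; ext
    simp only [LinearMap.mk₂_apply, one_mul, mul_one]
    module

end Symmetric

/-- A Jordan algebra `V` is representable if it is (isomorphic to) a Jordan subalgebra of the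
symmetric elements `S` of a finite-dimensional unital associative real algebra `A` with a
conjugation, such that `tr(x x') ≥ 0` on `A` and `S` is a Euclidean Jordan algebra.
Finite direct sums of such systems `(A, S, V)` are again of this form. -/
def IsRepresentable (V : Type*) [AddCommGroup V] [Module ℝ V] [JordanAlgebra V] : Prop :=
  ∃ (A : Type) (_ : Ring A) (_ : Algebra ℝ A) (_ : StarRing A) (_ : StarModule ℝ A),
    FiniteDimensional ℝ A ∧
    (∀ x : A, 0 ≤ LinearMap.trace ℝ A (LinearMap.mulLeft ℝ (x * star x))) ∧
    IsEuclidean (Sym A) ∧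
    ∃ ι : V →ₗ[ℝ] Sym A, Function.Injective ι ∧ ∀ x y, ι (jmul x y) = jmul (ι x) (ι y)

/-- The inner product of `V` is associative for the Jordan product, so that (in finite dimension)
`V` is a Euclidean Jordan algebra. -/
class AssociativeInner (V : Type*) [NormedAddCommGroup V] [InnerProductSpace ℝ V]
    [JordanAlgebra V] : Prop where
  inner_jmul : ∀ x y z : V, inner ℝ x (jmul y z) = inner ℝ (jmul x y) z

section Problem

variable {V : Type*} [NormedAddCommGroup V] [InnerProductSpace ℝ V] [FiniteDimensional ℝ V]
  [JordanAlgebra V]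

/-- The gradient of `F` with respect to the inner product of `V`. -/
def grad (F : V → ℝ) (x : V) : V :=
  haveI : CompleteSpace V := FiniteDimensional.complete ℝ V
  gradient F x

/-- The function `φ_u(x) = ⟨ln ∇F(x), u⟩`. -/
def phi (F : V → ℝ) (u x : V) : ℝ := inner ℝ (ln (grad F x)) u

variable (V) in
/-- The feasible set `{x ∈ K : ⟨e, x⟩ = 1}`, where `K` is the cone of squares. -/
def simplex : Set V := {x | x ∈ coneOfSquares V ∧ inner ℝ (e : V) x = 1}

/-- `F` is differentiable on `int K` with gradient there in `int K`, and `ln ∘ ∇F` is convex on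
the relative interior of the feasible set with respect to the order of the cone `K`. -/
def GradientLogConvex (F : V → ℝ) : Prop :=
  (∀ x ∈ interior (coneOfSquares V),
    DifferentiableAt ℝ F x ∧ grad F x ∈ interior (coneOfSquares V)) ∧
  ∀ x ∈ intrinsicInterior ℝ (simplex V), ∀ y ∈ intrinsicInterior ℝ (simplex V),
    ∀ t : ℝ, 0 ≤ t → t ≤ 1 →
      t • ln (grad F x) + (1 - t) • ln (grad F y) - ln (grad F (t • x + (1 - t) • y))
        ∈ coneOfSquares V

/-- The interior of the nonnegative orthant of `ℝ^m`. -/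
def posOrthant (m : ℕ) : Set (EuclideanSpace ℝ (Fin m)) := {y | ∀ j, 0 < y j}

/-- The linear operator maps `int K` to the open orthant, and its adjoint does the converse. -/
def IsAdmissible {m : ℕ} (T : V →ₗ[ℝ] EuclideanSpace ℝ (Fin m)) : Prop :=
  (∀ x ∈ interior (coneOfSquares V), T x ∈ posOrthant m) ∧
  ∀ y ∈ posOrthant m, LinearMap.adjoint T y ∈ interior (coneOfSquares V)

end Problem

/-- The weighted sum of logarithms `∑ j, w j * ln (y j)`. -/
def sumLogs {m : ℕ} (w : Fin m → ℝ) (y : EuclideanSpace ℝ (Fin m)) : ℝ :=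
  ∑ j, w j * Real.log (y j)

/-- The logarithm of the `p`-pseudo-norm, `p⁻¹ * ln (∑ j, (y j) ^ p)`. -/
def logPNorm {m : ℕ} (p : ℝ) (y : EuclideanSpace ℝ (Fin m)) : ℝ :=
  p⁻¹ * Real.log (∑ j, y j ^ p)

/-! ### Hermitian matrices -/

section Hermitian

variable (n : ℕ) (𝕜 : Type) [RCLike 𝕜]

/-- The Jordan algebra of `n × n` Hermitian matrices over `𝕜 = ℝ` or `ℂ`. -/
def Herm : Type := Sym (Matrix (Fin n) (Fin n) 𝕜)

instance : AddCommGroup (Herm n 𝕜) := inferInstanceAs (AddCommGroup (Sym (Matrix (Fin n) (Fin n) 𝕜)))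
instance : Module ℝ (Herm n 𝕜) := inferInstanceAs (Module ℝ (Sym (Matrix (Fin n) (Fin n) 𝕜)))
instance : JordanAlgebra (Herm n 𝕜) := inferInstanceAs (JordanAlgebra (Sym (Matrix (Fin n) (Fin n) 𝕜)))
instance : FiniteDimensional ℝ (Herm n 𝕜) :=
  inferInstanceAs (Module.Finite ℝ (Sym (Matrix (Fin n) (Fin n) 𝕜)))

variable {n 𝕜}

/-- The underlying matrix. -/
def Herm.mat (X : Herm n 𝕜) : Matrix (Fin n) (Fin n) 𝕜 := X.1

theorem Herm.star_mat (X : Herm n 𝕜) : X.mat.conjTranspose = X.mat := X.2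

/-- The inner product `⟨X, Y⟩ = tr(XY)`, which is real. -/
@[reducible] def Herm.core : InnerProductSpace.Core ℝ (Herm n 𝕜) where
  inner X Y := RCLike.re (X.mat * Y.mat).trace
  conj_inner_symm X Y := by
    simp [Matrix.trace_mul_comm Y.mat X.mat]
  re_inner_nonneg X := by
    have h : (X.mat * X.mat).trace = (X.mat.conjTranspose * X.mat).trace := by rw [X.star_mat]
    simp only [h]
    exact (RCLike.nonneg_iff.1 (Matrix.posSemidef_conjTranspose_mul_self X.mat).trace_nonneg).1
  add_left X Y Z := by
    have h : (X + Y).mat = X.mat + Y.mat := rfl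
    simp [h, add_mul]
  smul_left X Y r := by
    have h : (r • X).mat = r • X.mat := rfl
    simp [h, RCLike.smul_re]
  definite X hX := by
    have h : (X.mat * X.mat).trace = (X.mat.conjTranspose * X.mat).trace := by rw [X.star_mat]
    have h0 := RCLike.nonneg_iff.1 (Matrix.posSemidef_conjTranspose_mul_self X.mat).trace_nonneg
    have h1 : (X.mat.conjTranspose * X.mat).trace = 0 := by
      apply RCLike.ext
      · rw [← h]; simpa using hX
      · simpa using h0.2
    exact Subtype.ext (Matrix.trace_conjTranspose_mul_self_eq_zero_iff.1 h1)

instance : NormedAddCommGroup (Herm n 𝕜) := Herm.core.toNormedAddCommGroup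
instance : InnerProductSpace ℝ (Herm n 𝕜) := InnerProductSpace.ofCore Herm.core.toCore

theorem Herm.inner_def (X Y : Herm n 𝕜) : inner ℝ X Y = RCLike.re (X.mat * Y.mat).trace := rfl

instance : AssociativeInner (Herm n 𝕜) where
  inner_jmul X Y Z := by
    have h : ∀ P Q : Herm n 𝕜,
        (jmul P Q).mat = (2⁻¹ : ℝ) • (P.mat * Q.mat + Q.mat * P.mat) := fun _ _ => rfl
    simp only [Herm.inner_def, h, mul_smul_comm, smul_mul_assoc, mul_add, add_mul,
      Matrix.trace_smul, Matrix.trace_add, ← mul_assoc]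
    rw [Matrix.trace_mul_cycle X.mat Z.mat Y.mat]

/-- The rank-one Hermitian matrix `a a^H`. -/
def rankOne (a : Fin n → 𝕜) : Herm n 𝕜 :=
  ⟨Matrix.vecMulVec a (star a), by
    change Matrix.conjTranspose _ = _
    rw [Matrix.conjTranspose_vecMulVec, star_star]⟩

/-- The objective function of quantum state tomography with count `c j` in the `j`-th channel,
`N⁻¹ ∑ j, c j * ln ⟨X, a_j a_j^H⟩` where `N = ∑ j, c j`. -/
def qstObjective {m : ℕ} (c : Fin m → ℕ) (a : Fin m → Fin n → ℂ) (X : Herm n ℂ) : ℝ :=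
  (∑ j, (c j : ℝ))⁻¹ * ∑ j, (c j : ℝ) * Real.log (inner ℝ X (rankOne (a j)))

/-- The objective function `2 ln (∑ i, ⟨X, a_i a_iᵀ⟩^(1/2))` of the semidefinite relaxation of the
Boolean quadratic program, where `a_i` is the `i`-th column of the matrix `R`. -/
def bqpObjective (R : Matrix (Fin n) (Fin n) ℝ) (X : Herm n ℝ) : ℝ :=
  2 * Real.log (∑ i, √(inner ℝ X (rankOne (R.col i))))

end Hermitian

end EJA

end

/-!
The gradient of `F` has the form `∑ α_j(x) a_j` with fixed elements `a_j` of the cone of squares and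
positive weights whose reciprocals `1 / α_j` are concave in `x`: they are linear for a sum of
logarithms, and sums of weighted geometric means of linear functions for the logarithm of a
`p`-pseudo-norm. The theorem is therefore a consequence of the fact that `ln (∑ α_j a_j)` is convex
and decreasing in the numbers `1 / α_j` (`SymRep.ln_combination_mem`).

For this the algebra is realized by symmetric operators, in such a way that an element lies in the
cone of squares exactly if its operator is positive semidefinite (`SymRep`,
`SymRep.mem_coneOfSquares_iff`). A representable algebra acts on the associative algebra by left
multiplication; the trace form there may be degenerate, but no nonzero symmetric element is a null
vector (`eq_zero_of_traceForm_eq_zero`). Hermitian matrices act on column vectors.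

For operators, Thomson's principle describes the quadratic form of `(∑ α_j a_j + r)⁻¹` as a minimum
of functions that are linear and increasing in the `1 / α_j`, so that this inverse is concave and
increasing in them (`SymRep.concave_inverse`). The logarithm inherits convexity: the derivative of
`ln (g + r)` in `r` is `(g + r)⁻¹`, and the defect of convexity of `ln (g + r)` tends to `0` as `r`
tends to infinity (`SymRep.log_sum_le`). Pairing with `u` in the cone gives the convexity of `φ_u`
because the cone is contained in its dual (`SymRep.inner_nonneg`).
-/

namespace EJA

open JordanAlgebra Filter Topology Matrix

/-! ### Symmetric representations and the spectral theorem -/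

/-- A representation of a Jordan algebra `V` by linear operators on a real vector space `E` that
are symmetric for a symmetric positive semidefinite form. The product of `V` becomes
`(XY + YX)/2`, and only `0` acts by an operator whose values are all null vectors. The form may be
degenerate, `E` may be infinite-dimensional, and `e` is only required to act by an idempotent. -/
structure SymRep (V E : Type*) [AddCommGroup V] [Module ℝ V] [JordanAlgebra V]
    [AddCommGroup E] [Module ℝ E] where
  /-- the form on the representation space -/
  form : E →ₗ[ℝ] E →ₗ[ℝ] ℝ
  /-- the operators representing the elements of `V` -/
  act : V →ₗ[ℝ] Module.End ℝ E
  form_comm : ∀ v w, form v w = form w v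
  form_nonneg : ∀ v, 0 ≤ form v v
  act_jmul : ∀ x y, act (jmul x y) = (2⁻¹ : ℝ) • (act x * act y + act y * act x)
  form_act : ∀ x v w, form (act x v) w = form v (act x w)
  faithful : ∀ x, (∀ v, form (act x v) (act x v) = 0) → x = 0

namespace SymRep

section Algebra

variable {V E : Type*} [AddCommGroup V] [Module ℝ V] [JordanAlgebra V]
  [AddCommGroup E] [Module ℝ E] (ρ : SymRep V E)

theorem act_injective : Function.Injective ρ.act := by
  refine (injective_iff_map_eq_zero _).2 fun x hx => ρ.faithful x fun v => ?_
  simp [hx]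

theorem act_sq (x : V) : ρ.act (jmul x x) = ρ.act x * ρ.act x := by
  rw [ρ.act_jmul, ← two_smul ℝ, smul_smul]; simp

theorem act_e_sq : ρ.act e * ρ.act e = ρ.act e := by
  rw [← ρ.act_sq, e_jmul]

theorem act_e_mul_add (x : V) : ρ.act e * ρ.act x + ρ.act x * ρ.act e = (2 : ℝ) • ρ.act x := by
  have h := ρ.act_jmul e x
  rw [e_jmul] at h
  conv_rhs => rw [h, smul_smul]
  simp

/-- The idempotent by which `e` acts absorbs every represented operator. -/
theorem act_e_mul (x : V) : ρ.act e * ρ.act x = ρ.act x := by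
  have h := ρ.act_e_mul_add x
  have h1 : ρ.act e * ρ.act x * ρ.act e = ρ.act e * ρ.act x := by
    have := congrArg (ρ.act e * ·) h
    simp only [mul_add, ← mul_assoc, ρ.act_e_sq, two_smul] at this
    exact add_left_cancel this
  have h2 : ρ.act e * ρ.act x * ρ.act e = ρ.act x * ρ.act e := by
    have := congrArg (· * ρ.act e) h
    simp only [add_mul, mul_assoc, ρ.act_e_sq, two_smul] at this
    rw [mul_assoc]
    exact add_right_cancel this
  rw [← h2, h1, ← two_smul ℝ] at h
  exact smul_right_injective _ (two_ne_zero' ℝ) h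

theorem act_mul_e (x : V) : ρ.act x * ρ.act e = ρ.act x := by
  have h := ρ.act_e_mul_add x
  rw [ρ.act_e_mul, two_smul] at h
  exact add_left_cancel h

theorem act_jmul_of_commute {x y : V} (h : Commute (ρ.act x) (ρ.act y)) :
    ρ.act (jmul x y) = ρ.act x * ρ.act y := by
  rw [ρ.act_jmul, ← h.eq, ← two_smul ℝ, smul_smul]; simp

/-- Polynomials in multiplication by `x`, applied to `e`, are represented by polynomials in the
operator of `x`. -/
theorem act_aeval (x : V) (p : Polynomial ℝ) :
    ρ.act (Polynomial.aeval (jmul x) p e) = Polynomial.aeval (ρ.act x) p * ρ.act e := by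
  have hc : ∀ n, Commute (ρ.act x) (ρ.act x ^ n * ρ.act e) := fun n => by
    refine (Commute.self_pow _ _).mul_right ?_
    rw [Commute, SemiconjBy, ρ.act_e_mul, ρ.act_mul_e]
  have hpow : ∀ n, ρ.act ((jmul x ^ n) e) = ρ.act x ^ n * ρ.act e := by
    intro n
    induction n with
    | zero => simp
    | succ n ih =>
      rw [pow_succ', Module.End.mul_apply, ρ.act_jmul_of_commute (by rw [ih]; exact hc n), ih,
        pow_succ', mul_assoc]
  induction p using Polynomial.induction_on' with
  | add p q hp hq => simp [hp, hq, add_mul]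
  | monomial n c =>
    simp only [Polynomial.aeval_monomial, Module.End.mul_apply, Module.algebraMap_end_apply,
      map_smul, hpow]
    rw [mul_assoc, ← Algebra.smul_def]

/-- Power associativity: `p ↦ p(x)` is multiplicative, because it is so for operators. -/
theorem jmul_aeval (ρ : SymRep V E) (x : V) (p q : Polynomial ℝ) :
    jmul (Polynomial.aeval (jmul x) p e) (Polynomial.aeval (jmul x) q e) =
      Polynomial.aeval (jmul x) (p * q) (e : V) := by
  have hx : Commute (ρ.act e) (ρ.act x) := by
    rw [Commute, SemiconjBy, ρ.act_e_mul, ρ.act_mul_e]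
  have he : ∀ p : Polynomial ℝ, Commute (ρ.act e) (Polynomial.aeval (ρ.act x) p) := fun p =>
    (Polynomial.aeval_eq_sum_range (p := p) (ρ.act x)) ▸
      Commute.sum_right _ _ _ fun i _ => (hx.pow_right i).smul_right _
  have hpq : ∀ p q : Polynomial ℝ, Polynomial.aeval (ρ.act x) p * ρ.act e *
      (Polynomial.aeval (ρ.act x) q * ρ.act e) = Polynomial.aeval (ρ.act x) (p * q) * ρ.act e := by
    intro p q
    rw [mul_assoc, ← mul_assoc (ρ.act e), (he q).eq, mul_assoc, ρ.act_e_sq, map_mul, mul_assoc]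
  apply ρ.act_injective
  rw [ρ.act_jmul_of_commute, ρ.act_aeval, ρ.act_aeval, ρ.act_aeval, hpq]
  rw [Commute, SemiconjBy, ρ.act_aeval, ρ.act_aeval, hpq, hpq, mul_comm]

variable {ρ} in
/-- Orthogonality of an idempotent `x` to `y` in the Jordan sense gives `XY = 0`, and not only
`XY + YX = 0`, for the representing operators. -/
theorem act_orth {x y : V} (hx : jmul x x = x) (hxy : jmul x y = 0) :
    ρ.act x * ρ.act y = 0 := by
  have hX := ρ.act_sq x
  rw [hx] at hX
  have h := ρ.act_jmul x y
  rw [hxy, map_zero] at h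
  have h0 : ρ.act x * ρ.act y + ρ.act y * ρ.act x = 0 := by
    rcases smul_eq_zero.1 h.symm with h | h
    · norm_num at h
    · exact h
  have h1 := congrArg (ρ.act x * ·) h0
  have h2 := congrArg (· * ρ.act x) h0
  simp only [mul_add, add_mul, ← mul_assoc, ← hX, mul_zero, zero_mul] at h1 h2
  rw [mul_assoc (ρ.act y), ← hX] at h2
  have h3 : ρ.act x * ρ.act y = ρ.act y * ρ.act x := by
    rw [eq_neg_of_add_eq_zero_left h1, eq_neg_of_add_eq_zero_right h2]
  rw [← h3, ← two_smul ℝ] at h0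
  exact (smul_eq_zero.1 h0).resolve_left two_ne_zero

theorem exists_form_pos {q : V} (h0 : q ≠ 0) : ∃ v, 0 < ρ.form (ρ.act q v) (ρ.act q v) := by
  by_contra! h
  exact h0 (ρ.faithful q fun v => le_antisymm (h v) (ρ.form_nonneg _))

end Algebra

section Spectral

theorem isSymmetric_jmul {V : Type*} [NormedAddCommGroup V] [InnerProductSpace ℝ V]
    [JordanAlgebra V] [AssociativeInner V] (x : V) : (jmul x : V →ₗ[ℝ] V).IsSymmetric :=
  fun y z => by rw [jmul_comm, AssociativeInner.inner_jmul]

variable {V E : Type*} [NormedAddCommGroup V] [InnerProductSpace ℝ V] [FiniteDimensional ℝ V]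
  [JordanAlgebra V] [AssociativeInner V] [AddCommGroup E] [Module ℝ E]

/-- Multiplication by `x` is symmetric, hence diagonalizable, so it is annihilated by every
polynomial that vanishes at its eigenvalues. -/
theorem aeval_jmul_eq_zero (x : V) {p : Polynomial ℝ}
    (hp : ∀ t, (minpoly ℝ (jmul x)).IsRoot t → p.eval t = 0) :
    Polynomial.aeval (jmul x) p = 0 := by
  have h := (isSymmetric_jmul x).orthogonalComplement_iSup_eigenspaces_eq_bot
  rw [Submodule.orthogonal_eq_bot_iff] at h
  refine LinearMap.ext fun y => ?_
  have hy : y ∈ ⨆ μ, Module.End.eigenspace (jmul x) μ := h ▸ Submodule.mem_top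
  refine Submodule.iSup_induction _ (motive := fun y => Polynomial.aeval (jmul x) p y = 0) hy
    (fun μ z hz => ?_) (map_zero _) fun a b ha hb => by rw [map_add, ha, hb, add_zero]
  by_cases hz0 : z = 0
  · rw [hz0, map_zero]
  · have hv : Module.End.HasEigenvector (jmul x) μ z := ⟨hz, hz0⟩
    rw [Module.End.aeval_apply_of_hasEigenvector hv,
      hp μ (Module.End.isRoot_of_hasEigenvalue (Module.End.hasEigenvalue_of_hasEigenvector hv)),
      zero_smul]

/-- The spectral theorem: the idempotents are `p_λ(x)`, with `p_λ` the Lagrange basis polynomials at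
the eigenvalues `λ` of multiplication by `x`; those that vanish are discarded. -/
theorem exists_isSpectralDecomposition (ρ : SymRep V E) (x : V) :
    ∃ (k : ℕ) (μ : Fin k → ℝ) (q : Fin k → V),
      IsSpectralDecomposition x μ q ∧ ∀ i, q i ≠ 0 := by
  classical
  let s : Finset ℝ := (minpoly ℝ (jmul x)).roots.toFinset
  have hs : ∀ t, (minpoly ℝ (jmul x)).IsRoot t → t ∈ s := fun t ht => by
    simpa [s, minpoly.ne_zero (Algebra.IsIntegral.isIntegral (jmul x))] using ht
  let b : ℝ → Polynomial ℝ := Lagrange.basis s id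
  have hself : ∀ l ∈ s, (b l).eval l = 1 := fun l hl =>
    Lagrange.eval_basis_self (v := id) Function.injective_id.injOn hl
  have hne : ∀ l, ∀ t ∈ s, l ≠ t → (b l).eval t = 0 := fun l t ht h =>
    Lagrange.eval_basis_of_ne (v := id) h ht
  let q : ℝ → V := fun l => Polynomial.aeval (jmul x) (b l) e
  have heq : ∀ p p' : Polynomial ℝ, (∀ t ∈ s, p.eval t = p'.eval t) →
      Polynomial.aeval (jmul x) p (e : V) = Polynomial.aeval (jmul x) p' e := by
    intro p p' h
    have := aeval_jmul_eq_zero x (p := p - p') fun t ht => by simp [h t (hs t ht)]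
    rw [map_sub, sub_eq_zero] at this
    rw [this]
  have hsum : ∑ l ∈ s, q l = e := by
    have := heq (∑ l ∈ s, b l) 1 fun t ht => by
      rw [Polynomial.eval_finsetSum, Finset.sum_eq_single t (fun l _ h => hne l t ht h)
        (fun h => (h ht).elim), hself t ht, Polynomial.eval_one]
    simpa [q] using this
  have hx : ∑ l ∈ s, l • q l = x := by
    have := heq (∑ l ∈ s, l • b l) Polynomial.X fun t ht => by
      rw [Polynomial.eval_finsetSum, Finset.sum_eq_single t
        (fun l _ h => by rw [Polynomial.eval_smul, hne l t ht h, smul_zero])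
        (fun h => (h ht).elim), Polynomial.eval_smul, hself t ht, Polynomial.eval_X]
      simp
    simpa [q, jmul_comm x e, e_jmul] using this
  let s' : Finset ℝ := s.filter fun l => q l ≠ 0
  have htrans : ∀ f : ℝ → ℝ, ∑ i : Fin s'.card, f (s'.equivFin.symm i) • q (s'.equivFin.symm i)
      = ∑ l ∈ s, f l • q l := by
    intro f
    rw [Equiv.sum_comp s'.equivFin.symm (fun l : s' => f l • q l),
      Finset.sum_coe_sort s' fun l => f l • q l, Finset.sum_filter_of_ne]
    intro l _ h h0
    exact h (by rw [h0, smul_zero])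
  have hmem : ∀ i, (s'.equivFin.symm i : ℝ) ∈ s := fun i =>
    (Finset.mem_filter.1 (s'.equivFin.symm i).2).1
  refine ⟨s'.card, fun i => s'.equivFin.symm i, fun i => q (s'.equivFin.symm i),
    ⟨fun i => ?_, fun i j hij => ?_, ?_, ?_⟩, fun i =>
      (Finset.mem_filter.1 (s'.equivFin.symm i).2).2⟩
  · refine (ρ.jmul_aeval x _ _).trans (heq _ _ fun t ht => ?_)
    rw [Polynomial.eval_mul]
    by_cases h : (s'.equivFin.symm i : ℝ) = t
    · rw [h, hself t ht, one_mul]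
    · rw [hne _ t ht h, zero_mul]
  · have hij' : (s'.equivFin.symm i : ℝ) ≠ s'.equivFin.symm j := fun h =>
      hij (s'.equivFin.symm.injective (Subtype.ext h))
    refine (ρ.jmul_aeval x _ _).trans ((heq _ 0 fun t ht => ?_).trans (by simp))
    rw [Polynomial.eval_mul, Polynomial.eval_zero]
    by_cases h : (s'.equivFin.symm i : ℝ) = t
    · rw [hne _ t ht fun h' => hij' (h.trans h'.symm), mul_zero]
    · rw [hne _ t ht h, zero_mul]
  · simpa [hsum] using htrans fun _ => 1
  · exact hx.symm.trans (htrans id).symm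

end Spectral

end SymRep

/-! ### The cone of squares -/

namespace SymRep

section Algebra

variable {V E : Type*} [AddCommGroup V] [Module ℝ V] [JordanAlgebra V]
  [AddCommGroup E] [Module ℝ E]

theorem form_nonneg_of_mem (ρ : SymRep V E) {x : V} (hx : x ∈ coneOfSquares V) (v : E) :
    0 ≤ ρ.form (ρ.act x v) v := by
  obtain ⟨y, rfl⟩ := hx
  rw [ρ.act_sq, Module.End.mul_apply, ρ.form_act]
  exact ρ.form_nonneg _

theorem act_spectral_apply (ρ : SymRep V E) {k : ℕ} {x : V} {μ : Fin k → ℝ} {q : Fin k → V}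
    (h : IsSpectralDecomposition x μ q) (i : Fin k) :
    ρ.act x * ρ.act (q i) = μ i • ρ.act (q i) := by
  conv_lhs => rw [h.eq_sum]
  rw [map_sum, Finset.sum_mul, Finset.sum_eq_single i]
  · rw [map_smul, smul_mul_assoc, ← ρ.act_sq, h.idem]
  · intro j _ hj
    rw [map_smul, smul_mul_assoc, act_orth (h.idem j) (h.orth j i hj), smul_zero]
  · simp

/-- Lower bounds for the quadratic form of `x` on the range of a spectral idempotent are lower bounds
for the corresponding eigenvalue. -/
theorem le_of_form_le (ρ : SymRep V E) {k : ℕ} {x : V} {μ : Fin k → ℝ} {q : Fin k → V}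
    (h : IsSpectralDecomposition x μ q) {i : Fin k} (hq : q i ≠ 0)
    (c : ℝ) (hx : ∀ v, c * ρ.form (ρ.act (q i) v) (ρ.act (q i) v) ≤
      ρ.form (ρ.act x (ρ.act (q i) v)) (ρ.act (q i) v)) : c ≤ μ i := by
  obtain ⟨v, hv⟩ := ρ.exists_form_pos hq
  have := hx v
  rw [← Module.End.mul_apply, ρ.act_spectral_apply h] at this
  simp only [LinearMap.smul_apply, map_smul, smul_eq_mul] at this
  exact le_of_mul_le_mul_right this hv

theorem _root_.EJA.IsSpectralDecomposition.mem_coneOfSquares {k : ℕ} {x : V} {μ : Fin k → ℝ}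
    {q : Fin k → V} (h : IsSpectralDecomposition x μ q) (hμ : ∀ i, 0 ≤ μ i) :
    x ∈ coneOfSquares V := by
  refine ⟨∑ i, √(μ i) • q i, ?_⟩
  conv_lhs => rw [h.eq_sum]
  simp only [map_sum, LinearMap.sum_apply, map_smul, LinearMap.smul_apply]
  refine Finset.sum_congr rfl fun i _ => ?_
  rw [Finset.sum_eq_single i]
  · rw [h.idem, smul_smul, Real.mul_self_sqrt (hμ i)]
  · intro j _ hj
    rw [h.orth j i hj, smul_zero]
  · simp

end Algebra

theorem exists_sub_smul_mem {V : Type*} [NormedAddCommGroup V] [InnerProductSpace ℝ V]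
    [JordanAlgebra V] {x z : V} (hx : x ∈ interior (coneOfSquares V)) :
    ∃ ε : ℝ, 0 < ε ∧ x - ε • z ∈ coneOfSquares V := by
  have hc : ContinuousAt (fun ε : ℝ => x - ε • z) 0 := by fun_prop
  have := hc.preimage_mem_nhds (t := coneOfSquares V)
    (by simpa using mem_interior_iff_mem_nhds.1 hx)
  obtain ⟨δ, hδ, h⟩ := Metric.mem_nhds_iff.1 this
  refine ⟨δ / 2, by positivity, h ?_⟩
  rw [Metric.mem_ball, Real.dist_eq, sub_zero, abs_of_pos (by positivity)]
  linarith

theorem pos_of_mem_interior {V E : Type*} [NormedAddCommGroup V] [InnerProductSpace ℝ V]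
    [JordanAlgebra V] [AddCommGroup E] [Module ℝ E] (ρ : SymRep V E) {k : ℕ} {x : V}
    {μ : Fin k → ℝ} {q : Fin k → V} (h : IsSpectralDecomposition x μ q)
    (hx : x ∈ interior (coneOfSquares V)) {i : Fin k} (hq : q i ≠ 0) : 0 < μ i := by
  obtain ⟨ε, hε, hm⟩ := exists_sub_smul_mem (z := e) hx
  refine hε.trans_le (ρ.le_of_form_le h hq ε fun v => ?_)
  have := ρ.form_nonneg_of_mem hm (ρ.act (q i) v)
  have he : ρ.act e (ρ.act (q i) v) = ρ.act (q i) v := by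
    rw [← Module.End.mul_apply, ρ.act_e_mul]
  simp only [map_sub, map_smul, LinearMap.sub_apply, LinearMap.smul_apply, smul_eq_mul, he] at this
  linarith

/-- Multiplication `L` by an idempotent is positive semidefinite: its eigenvalues are among `0`,
`1/2`, `1`, and with `D = L - L²` this amounts to the identity `L = L² + 4 D²`. -/
theorem inner_idem_jmul_nonneg {V E : Type*} [NormedAddCommGroup V] [InnerProductSpace ℝ V]
    [JordanAlgebra V] [AssociativeInner V] [AddCommGroup E] [Module ℝ E] (ρ : SymRep V E)
    {q : V} (hq : jmul q q = q) (y : V) :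
    0 ≤ inner ℝ (jmul q y) y := by
  have hQ : ρ.act q * ρ.act q = ρ.act q := by rw [← ρ.act_sq, hq]
  have hQ' : ∀ Z, ρ.act q * (ρ.act q * Z) = ρ.act q * Z := fun Z => by rw [← mul_assoc, hQ]
  let d : V → V := fun z => jmul q z - jmul q (jmul q z)
  have hd : jmul q y = jmul q (jmul q y) + (4 : ℝ) • d (d y) := by
    apply ρ.act_injective
    simp only [d, map_add, map_sub, map_smul, ρ.act_jmul, mul_add, add_mul,
      smul_add, smul_sub, mul_smul_comm, smul_mul_assoc, mul_assoc, hQ, hQ']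
    module
  have hs : ∀ z w : V, inner ℝ (jmul q z) w = inner ℝ z (jmul q w) := fun z w =>
    isSymmetric_jmul q z w
  have hds : ∀ z w : V, inner ℝ (d z) w = inner ℝ z (d w) := fun z w => by
    simp only [d, inner_sub_left, inner_sub_right, hs]
  rw [hd, inner_add_left, inner_smul_left, hs, hds]
  have h1 := real_inner_self_nonneg (x := jmul q y)
  have h2 := real_inner_self_nonneg (x := d y)
  simp only [conj_trivial]
  linarith

variable {V E : Type*} [NormedAddCommGroup V] [InnerProductSpace ℝ V] [FiniteDimensional ℝ V]
  [JordanAlgebra V] [AssociativeInner V] [AddCommGroup E] [Module ℝ E]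

theorem mem_coneOfSquares_iff (ρ : SymRep V E) {x : V} :
    x ∈ coneOfSquares V ↔ ∀ v, 0 ≤ ρ.form (ρ.act x v) v := by
  refine ⟨fun hx => ρ.form_nonneg_of_mem hx, fun hx => ?_⟩
  obtain ⟨k, μ, q, h, hq⟩ := exists_isSpectralDecomposition ρ x
  refine h.mem_coneOfSquares fun i => ρ.le_of_form_le h (hq i) 0 fun v => ?_
  rw [zero_mul]
  exact hx _

theorem isClosed_coneOfSquares (ρ : SymRep V E) : IsClosed (coneOfSquares V) := by
  have : coneOfSquares V = ⋂ v, {x | 0 ≤ (ρ.form.flip v ∘ₗ ρ.act.flip v) x} := by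
    ext x
    simp [ρ.mem_coneOfSquares_iff]
  rw [this]
  exact isClosed_iInter fun v =>
    isClosed_le continuous_const (LinearMap.continuous_of_finiteDimensional _)

theorem add_mem (ρ : SymRep V E) {x y : V} (hx : x ∈ coneOfSquares V) (hy : y ∈ coneOfSquares V) :
    x + y ∈ coneOfSquares V := by
  rw [ρ.mem_coneOfSquares_iff] at *
  intro v
  simpa using add_nonneg (hx v) (hy v)

theorem smul_mem (ρ : SymRep V E) {x : V} (hx : x ∈ coneOfSquares V) {c : ℝ} (hc : 0 ≤ c) :
    c • x ∈ coneOfSquares V := by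
  rw [ρ.mem_coneOfSquares_iff] at *
  intro v
  simpa using mul_nonneg hc (hx v)

theorem convex_coneOfSquares (ρ : SymRep V E) : Convex ℝ (coneOfSquares V) :=
  fun _ hx _ hy _ _ ha hb _ => ρ.add_mem (ρ.smul_mem hx ha) (ρ.smul_mem hy hb)

/-- An eigenvalue `μ` of `x` is an eigenvalue of multiplication by `x`, so `|μ - 1|` is at most a
constant times `‖x - e‖`, and all eigenvalues are nonnegative for `x` close to `e`. -/
theorem e_mem_interior (ρ : SymRep V E) : (e : V) ∈ interior (coneOfSquares V) := by
  let L : V →L[ℝ] V →L[ℝ] V :=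
    LinearMap.toContinuousLinearMap (LinearMap.toContinuousLinearMap.toLinearMap ∘ₗ jmul)
  have hL : ∀ x y, L x y = jmul x y := fun _ _ => rfl
  have hC : 0 < ‖L‖ + 1 := by positivity
  rw [mem_interior_iff_mem_nhds, Metric.mem_nhds_iff]
  refine ⟨(‖L‖ + 1)⁻¹, by positivity, fun x hx => ?_⟩
  obtain ⟨k, μ, q, h, hq⟩ := exists_isSpectralDecomposition ρ x
  refine h.mem_coneOfSquares fun i => ?_
  have hxq : jmul x (q i) = μ i • q i := by
    apply ρ.act_injective
    rw [ρ.act_jmul_of_commute, ρ.act_spectral_apply h, map_smul]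
    rw [Commute, SemiconjBy, h.eq_sum]
    simp only [map_sum, Finset.sum_mul, Finset.mul_sum, map_smul, smul_mul_assoc, mul_smul_comm]
    refine Finset.sum_congr rfl fun j _ => ?_
    by_cases hj : j = i
    · rw [hj]
    · rw [act_orth (h.idem j) (h.orth j i hj), act_orth (h.idem i) (h.orth i j (Ne.symm hj))]
  have h1 : (μ i - 1) • q i = L (x - e) (q i) := by
    rw [hL, map_sub, LinearMap.sub_apply, hxq, e_jmul, sub_smul, one_smul]
  have h2 : |μ i - 1| * ‖q i‖ ≤ 1 * ‖q i‖ := by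
    rw [← Real.norm_eq_abs, ← norm_smul, h1]
    refine (L.le_opNorm₂ _ _).trans (mul_le_mul_of_nonneg_right ?_ (norm_nonneg _))
    rw [mem_ball_iff_norm] at hx
    calc ‖L‖ * ‖x - e‖ ≤ (‖L‖ + 1) * (‖L‖ + 1)⁻¹ := by gcongr; linarith
      _ = 1 := mul_inv_cancel₀ hC.ne'
  have h3 := (abs_le.1 (le_of_mul_le_mul_right h2 (norm_pos_iff.2 (hq i)))).1
  linarith

theorem add_mem_interior (ρ : SymRep V E) {x y : V} (hx : x ∈ coneOfSquares V)
    (hy : y ∈ interior (coneOfSquares V)) : x + y ∈ interior (coneOfSquares V) := by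
  have hopen : IsOpen ((fun z => -x + z) ⁻¹' interior (coneOfSquares V)) :=
    isOpen_interior.preimage (by fun_prop)
  refine interior_maximal (fun z hz => ?_) hopen (by simpa using hy)
  simpa using ρ.add_mem hx (interior_subset hz)

theorem smul_mem_interior (ρ : SymRep V E) {x : V} (hx : x ∈ interior (coneOfSquares V)) {c : ℝ}
    (hc : 0 < c) : c • x ∈ interior (coneOfSquares V) := by
  have hopen : IsOpen ((fun z : V => c⁻¹ • z) ⁻¹' interior (coneOfSquares V)) :=
    isOpen_interior.preimage (by fun_prop)
  refine interior_maximal (fun z hz => ?_) hopen (by simpa [smul_smul, hc.ne'] using hx)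
  simpa [smul_smul, hc.ne'] using ρ.smul_mem (interior_subset hz) hc.le

theorem exists_isSpectralDecomposition_pos (ρ : SymRep V E) {x : V}
    (hx : x ∈ interior (coneOfSquares V)) :
    ∃ (k : ℕ) (μ : Fin k → ℝ) (q : Fin k → V), IsSpectralDecomposition x μ q ∧ ∀ i, 0 < μ i := by
  obtain ⟨k, μ, q, h, hq⟩ := exists_isSpectralDecomposition ρ x
  exact ⟨k, μ, q, h, fun i => ρ.pos_of_mem_interior h hx (hq i)⟩

theorem mem_interior_of_form_pos (ρ : SymRep V E) {x : V}
    (hx : ∀ v, ρ.form v v ≠ 0 → 0 < ρ.form (ρ.act x v) v) :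
    x ∈ interior (coneOfSquares V) := by
  obtain ⟨k, μ, q, h, hq⟩ := exists_isSpectralDecomposition ρ x
  have hμ : ∀ i, 0 < μ i := fun i => by
    obtain ⟨v, hv⟩ := ρ.exists_form_pos (hq i)
    have := hx _ hv.ne'
    rw [← Module.End.mul_apply, ρ.act_spectral_apply h] at this
    simp only [LinearMap.smul_apply, map_smul, smul_eq_mul] at this
    exact pos_of_mul_pos_left this hv.le
  obtain ⟨ε, hε, hle⟩ : ∃ ε > 0, ∀ i, ε ≤ μ i := by
    rcases isEmpty_or_nonempty (Fin k) with hk | hk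
    · exact ⟨1, one_pos, fun i => hk.elim i⟩
    · obtain ⟨i, hi⟩ := Finite.exists_min μ
      exact ⟨μ i, hμ i, hi⟩
  have hd : IsSpectralDecomposition (x - ε • e) (fun i => μ i - ε) q :=
    ⟨h.idem, h.orth, h.complete, by
      conv_lhs => rw [h.eq_sum, ← h.complete]
      simp only [sub_smul, Finset.sum_sub_distrib, Finset.smul_sum]⟩
  have := ρ.add_mem_interior (hd.mem_coneOfSquares fun i => sub_nonneg.2 (hle i))
    (ρ.smul_mem_interior ρ.e_mem_interior hε)
  simpa using this

/-- Half of the self-duality of the cone of squares. -/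
theorem inner_nonneg (ρ : SymRep V E) {x y : V} (hx : x ∈ coneOfSquares V)
    (hy : y ∈ coneOfSquares V) : 0 ≤ inner ℝ x y := by
  obtain ⟨k, μ, q, h, hq⟩ := exists_isSpectralDecomposition ρ x
  obtain ⟨z, rfl⟩ := hy
  rw [h.eq_sum, sum_inner]
  refine Finset.sum_nonneg fun i _ => ?_
  rw [inner_smul_left, AssociativeInner.inner_jmul]
  refine mul_nonneg ?_ (ρ.inner_idem_jmul_nonneg (h.idem i) z)
  refine ρ.le_of_form_le h (hq i) 0 fun v => ?_
  rw [zero_mul]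
  exact ρ.form_nonneg_of_mem hx _

/-- A relatively interior point of the simplex remains in it when pushed a little away from the
multiple `c` of `e` in it; so it is a proper convex combination of a point of the cone with the
interior point `c`. -/
theorem intrinsicInterior_simplex_subset (ρ : SymRep V E) :
    intrinsicInterior ℝ (simplex V) ⊆ interior (coneOfSquares V) := by
  intro x hx
  have hxs : x ∈ simplex V := intrinsicInterior_subset hx
  have he : (e : V) ≠ 0 := by
    intro h
    have := hxs.2
    rw [h, inner_zero_left] at this
    exact zero_ne_one this
  have hee : 0 < inner ℝ (e : V) e := real_inner_self_pos.2 he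
  let c : V := (inner ℝ (e : V) e)⁻¹ • e
  have hci : c ∈ interior (coneOfSquares V) :=
    ρ.smul_mem_interior ρ.e_mem_interior (inv_pos.2 hee)
  have hcs : c ∈ simplex V := ⟨interior_subset hci, by
    rw [inner_smul_right, inv_mul_cancel₀ hee.ne']⟩
  obtain ⟨y, hy, rfl⟩ := mem_intrinsicInterior.1 hx
  let γ : ℝ → affineSpan ℝ (simplex V) := fun δ =>
    ⟨AffineMap.lineMap (y : V) c (-δ), AffineMap.lineMap_mem _ y.2 (subset_affineSpan ℝ _ hcs)⟩
  have hγ : Continuous γ := by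
    refine Continuous.subtype_mk ?_ _
    simp only [AffineMap.lineMap_apply_module]
    fun_prop
  have hγ0 : γ 0 = y := Subtype.ext (by simp [γ])
  have hnhds := hγ.continuousAt.preimage_mem_nhds (x := 0)
    (by rw [hγ0]; exact mem_interior_iff_mem_nhds.1 hy)
  obtain ⟨δ, hδ, h⟩ := Metric.mem_nhds_iff.1 hnhds
  have hmem : γ (δ / 2) ∈ ((↑) ⁻¹' simplex V : Set (affineSpan ℝ (simplex V))) := h (by
    rw [Metric.mem_ball, Real.dist_eq, sub_zero, abs_of_pos (by positivity)]
    linarith)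
  have hK : (1 + δ / 2) • (y : V) - (δ / 2) • c ∈ coneOfSquares V := by
    have := hmem.1
    simp only [γ, AffineMap.lineMap_apply_module] at this
    convert this using 1
    module
  have := ρ.smul_mem_interior (ρ.add_mem_interior hK
    (ρ.smul_mem_interior hci (half_pos hδ))) (c := (1 + δ / 2)⁻¹) (by positivity)
  rw [sub_add_cancel, smul_smul, inv_mul_cancel₀ (by positivity), one_smul] at this
  exact this

end SymRep

/-! ### Order convexity of the logarithm of a weighted sum -/

namespace SymRep

section Algebra

variable {V E : Type*} [AddCommGroup V] [Module ℝ V] [JordanAlgebra V]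
  [AddCommGroup E] [Module ℝ E]

theorem _root_.EJA.IsSpectralDecomposition.add_smul_e {k : ℕ} {x : V} {μ : Fin k → ℝ}
    {q : Fin k → V} (h : IsSpectralDecomposition x μ q) (s : ℝ) :
    IsSpectralDecomposition (x + s • e) (fun i => μ i + s) q :=
  ⟨h.idem, h.orth, h.complete, by
    conv_lhs => rw [h.eq_sum, ← h.complete]
    simp only [add_smul, Finset.sum_add_distrib, Finset.smul_sum]⟩

theorem _root_.EJA.IsSpectralDecomposition.ln_eq {k : ℕ} {x : V} {μ : Fin k → ℝ}
    {q : Fin k → V} (h : IsSpectralDecomposition x μ q) : ln x = ∑ i, Real.log (μ i) • q i :=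
  IsSpectralValue.spectralMap_eq ⟨k, μ, q, h, rfl⟩

theorem act_mul_act_inv (ρ : SymRep V E) {k : ℕ} {x : V} {μ : Fin k → ℝ} {q : Fin k → V}
    (h : IsSpectralDecomposition x μ q) (hμ : ∀ i, μ i ≠ 0) :
    ρ.act x * ρ.act (∑ i, (μ i)⁻¹ • q i) = ρ.act e := by
  rw [map_sum, Finset.mul_sum, ← h.complete, map_sum]
  refine Finset.sum_congr rfl fun i _ => ?_
  rw [map_smul, mul_smul_comm, ρ.act_spectral_apply h, smul_smul, inv_mul_cancel₀ (hμ i), one_smul]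

theorem form_bilin_comm (ρ : SymRep V E) (x : V) (v w : E) :
    ρ.form (ρ.act x v) w = ρ.form (ρ.act x w) v := by
  rw [ρ.form_act, ρ.form_comm]

/-- Nonnegativity of the quadratic form of `b` at `γ w - α v`. -/
theorem two_mul_form_le (ρ : SymRep V E) {b : V} (hb : b ∈ coneOfSquares V) {α γ : ℝ} (hα : 0 < α)
    (v w : E) : 2 * (γ * ρ.form (ρ.act b w) v) ≤
      γ ^ 2 / α * ρ.form (ρ.act b w) w + α * ρ.form (ρ.act b v) v := by
  have h := ρ.form_nonneg_of_mem hb (γ • w - α • v)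
  simp only [map_sub, map_smul, LinearMap.sub_apply, LinearMap.smul_apply, smul_eq_mul,
    ρ.form_bilin_comm b v w] at h
  rw [div_mul_eq_mul_div, div_add' _ _ _ hα.ne', le_div_iff₀ hα]
  linarith

variable {J : Type*}

theorem form_act_sum_add (ρ : SymRep V E) (s : Finset J) (a : J → V) (c : V) (γ : J → ℝ)
    (v w : E) : ρ.form (ρ.act (∑ j ∈ s, γ j • a j + c) w) v =
      ∑ j ∈ s, γ j * ρ.form (ρ.act (a j) w) v + ρ.form (ρ.act c w) v := by
  simp [LinearMap.sum_apply]

/-- Thomson's principle for the quadratic form of the inverse of `∑ α_j a_j + c`: it is bounded by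
an energy that depends on the weights `α_j` only through `1 / α_j`, and linearly. The flow used for
the bound comes from the solution `w` for any other weights `γ_j`. -/
theorem form_le_of_act_eq (ρ : SymRep V E) {s : Finset J} {a : J → V} {c : V}
    (ha : ∀ j ∈ s, a j ∈ coneOfSquares V) (hc : c ∈ coneOfSquares V) {α γ : J → ℝ}
    (hα : ∀ j ∈ s, 0 < α j) {u v w : E} (hu : ρ.act (∑ j ∈ s, α j • a j + c) u = v)
    (hw : ρ.act (∑ j ∈ s, γ j • a j + c) w = v) :
    ρ.form v u ≤
      ∑ j ∈ s, γ j ^ 2 / α j * ρ.form (ρ.act (a j) w) w + ρ.form (ρ.act c w) w := by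
  have h1 := ρ.form_act_sum_add s a c α u u
  have h2 := ρ.form_act_sum_add s a c γ u w
  rw [hu] at h1
  rw [hw] at h2
  have h3 := Finset.sum_le_sum fun j hj =>
    ρ.two_mul_form_le (ha j hj) (γ := γ j) (hα j hj) u w
  have h4 := ρ.two_mul_form_le hc (γ := 1) one_pos u w
  rw [← Finset.mul_sum, Finset.sum_add_distrib] at h3
  norm_num at h4
  linarith

/-- The inverse of `∑ α_j a_j + c` is concave as a function of the numbers `1 / α_j` and increasing
in them. -/
theorem concave_inverse (ρ : SymRep V E) {s : Finset J} {a : J → V} {c : V}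
    (ha : ∀ j ∈ s, a j ∈ coneOfSquares V) (hc : c ∈ coneOfSquares V) {α β γ : J → ℝ}
    (hα : ∀ j ∈ s, 0 < α j) (hβ : ∀ j ∈ s, 0 < β j) (hγ : ∀ j ∈ s, 0 < γ j) {t : ℝ} (ht : 0 ≤ t)
    (ht' : t ≤ 1) (h : ∀ j ∈ s, t / α j + (1 - t) / β j ≤ 1 / γ j) {u u' v w : E}
    (hu : ρ.act (∑ j ∈ s, α j • a j + c) u = v) (hu' : ρ.act (∑ j ∈ s, β j • a j + c) u' = v)
    (hw : ρ.act (∑ j ∈ s, γ j • a j + c) w = v) :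
    t * ρ.form v u + (1 - t) * ρ.form v u' ≤ ρ.form v w := by
  have h1 := mul_le_mul_of_nonneg_left (ρ.form_le_of_act_eq ha hc hα hu hw) ht
  have h2 := mul_le_mul_of_nonneg_left (ρ.form_le_of_act_eq ha hc hβ hu' hw) (sub_nonneg.2 ht')
  have h3 := ρ.form_act_sum_add s a c γ w w
  rw [hw] at h3
  have h4 : t * ∑ j ∈ s, γ j ^ 2 / α j * ρ.form (ρ.act (a j) w) w +
      (1 - t) * ∑ j ∈ s, γ j ^ 2 / β j * ρ.form (ρ.act (a j) w) w ≤
      ∑ j ∈ s, γ j * ρ.form (ρ.act (a j) w) w := by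
    rw [Finset.mul_sum, Finset.mul_sum, ← Finset.sum_add_distrib]
    refine Finset.sum_le_sum fun j hj => ?_
    have h5 : γ j ^ 2 * (t / α j + (1 - t) / β j) ≤ γ j := by
      refine (mul_le_mul_of_nonneg_left (h j hj) (sq_nonneg _)).trans_eq ?_
      field_simp [(hγ j hj).ne']
    calc _ = γ j ^ 2 * (t / α j + (1 - t) / β j) * ρ.form (ρ.act (a j) w) w := by ring
      _ ≤ _ := mul_le_mul_of_nonneg_right h5 (ρ.form_nonneg_of_mem (ha j hj) w)
  linarith

end Algebra

theorem hasDerivAt_sum_mul_log {k : ℕ} (c μ : Fin k → ℝ) (hμ : ∀ i, 0 < μ i) {r : ℝ} (hr : 0 ≤ r) :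
    HasDerivAt (fun r => ∑ i, c i * Real.log (μ i + r)) (∑ i, c i * (μ i + r)⁻¹) r := by
  refine HasDerivAt.fun_sum fun i _ => ?_
  have := ((hasDerivAt_id r).const_add (μ i)).log (by have := hμ i; simp only [id]; positivity)
  simpa using this.const_mul (c i)

theorem tendsto_sum_mul_log {k : ℕ} (c μ : Fin k → ℝ) :
    Tendsto (fun r => ∑ i, c i * Real.log (μ i + r) - (∑ i, c i) * Real.log r) atTop (𝓝 0) := by
  have : ∀ i, Tendsto (fun r => c i * (Real.log (r + μ i) - Real.log r)) atTop (𝓝 0) := fun i => by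
    simpa using (Real.tendsto_log_comp_add_sub_log (μ i)).const_mul (c i)
  have h := tendsto_finsetSum Finset.univ fun i _ => this i
  simp only [Finset.sum_const_zero, mul_sub, Finset.sum_sub_distrib] at h
  simpa only [Finset.sum_mul, add_comm] using h

/-- An inequality between the resolvents of three weighted spectra of equal total mass gives the
reverse inequality between their logarithms: the difference of the logarithms, shifted by `r`, is
antitone in `r` and tends to zero at infinity. -/
theorem log_sum_le {k l m : ℕ} {c μ : Fin k → ℝ} {d ν : Fin l → ℝ} {b κ : Fin m → ℝ}
    (hμ : ∀ i, 0 < μ i) (hν : ∀ i, 0 < ν i) (hκ : ∀ i, 0 < κ i) {t : ℝ}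
    (hcb : ∑ i, c i = ∑ i, b i) (hdb : ∑ i, d i = ∑ i, b i)
    (h : ∀ r : ℝ, 0 ≤ r → t * ∑ i, c i * (μ i + r)⁻¹ + (1 - t) * ∑ i, d i * (ν i + r)⁻¹ ≤
      ∑ i, b i * (κ i + r)⁻¹) :
    ∑ i, b i * Real.log (κ i) ≤
      t * ∑ i, c i * Real.log (μ i) + (1 - t) * ∑ i, d i * Real.log (ν i) := by
  let D : ℝ → ℝ := fun r => t * ∑ i, c i * Real.log (μ i + r) +
    (1 - t) * ∑ i, d i * Real.log (ν i + r) - ∑ i, b i * Real.log (κ i + r)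
  have hD : ∀ r : ℝ, 0 ≤ r → HasDerivAt D (t * ∑ i, c i * (μ i + r)⁻¹ +
      (1 - t) * ∑ i, d i * (ν i + r)⁻¹ - ∑ i, b i * (κ i + r)⁻¹) r := fun r hr =>
    (((hasDerivAt_sum_mul_log c μ hμ hr).const_mul t).add
      ((hasDerivAt_sum_mul_log d ν hν hr).const_mul (1 - t))).sub
      (hasDerivAt_sum_mul_log b κ hκ hr)
  have hanti : AntitoneOn D (Set.Ici 0) := by
    refine antitoneOn_of_deriv_nonpos (convex_Ici 0)
      (fun r hr => (hD r hr).continuousAt.continuousWithinAt)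
      (fun r hr => (hD r (interior_subset hr)).differentiableAt.differentiableWithinAt)
      fun r hr => ?_
    rw [(hD r (interior_subset hr)).deriv]
    exact sub_nonpos.2 (h r (interior_subset hr))
  have hlim : Tendsto D atTop (𝓝 0) := by
    have := ((((tendsto_sum_mul_log c μ).const_mul t).add
      ((tendsto_sum_mul_log d ν).const_mul (1 - t))).sub (tendsto_sum_mul_log b κ))
    simp only [mul_zero, add_zero, sub_zero, hcb, hdb] at this
    refine this.congr fun r => ?_
    simp only [D]
    ring
  have h0 : 0 ≤ D 0 := le_of_tendsto hlim <|
    (eventually_ge_atTop 0).mono fun r hr => hanti Set.self_mem_Ici hr hr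
  simp only [D, add_zero] at h0
  linarith

variable {V E : Type*} [NormedAddCommGroup V] [InnerProductSpace ℝ V] [FiniteDimensional ℝ V]
  [JordanAlgebra V] [AssociativeInner V] [AddCommGroup E] [Module ℝ E] {J : Type*}

/-- `ln (∑ α_j a_j)` is convex as a function of the numbers `1 / α_j` and decreasing in them. -/
theorem ln_combination_mem (ρ : SymRep V E) {s : Finset J} {a : J → V}
    (ha : ∀ j ∈ s, a j ∈ coneOfSquares V) {α β γ : J → ℝ}
    (hα : ∀ j ∈ s, 0 < α j) (hβ : ∀ j ∈ s, 0 < β j) (hγ : ∀ j ∈ s, 0 < γ j) {t : ℝ} (ht : 0 ≤ t)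
    (ht' : t ≤ 1) (h : ∀ j ∈ s, t / α j + (1 - t) / β j ≤ 1 / γ j)
    (hαi : ∑ j ∈ s, α j • a j ∈ interior (coneOfSquares V))
    (hβi : ∑ j ∈ s, β j • a j ∈ interior (coneOfSquares V))
    (hγi : ∑ j ∈ s, γ j • a j ∈ interior (coneOfSquares V)) :
    t • ln (∑ j ∈ s, α j • a j) + (1 - t) • ln (∑ j ∈ s, β j • a j) - ln (∑ j ∈ s, γ j • a j)
      ∈ coneOfSquares V := by
  obtain ⟨k, μ, q, hq, hμ⟩ := ρ.exists_isSpectralDecomposition_pos hαi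
  obtain ⟨k', ν, q', hq', hν⟩ := ρ.exists_isSpectralDecomposition_pos hβi
  obtain ⟨k'', κ, q'', hq'', hκ⟩ := ρ.exists_isSpectralDecomposition_pos hγi
  rw [ρ.mem_coneOfSquares_iff]
  intro v
  -- The resolvent `(x + r)⁻¹` at `v`, and its quadratic form in terms of the spectrum.
  have hres : ∀ {k : ℕ} {x : V} {μ : Fin k → ℝ} {q : Fin k → V} (_ : IsSpectralDecomposition x μ q)
      (_ : ∀ i, 0 < μ i) {r : ℝ} (_ : 0 ≤ r), ∃ u, ρ.act (x + r • e) u = ρ.act e v ∧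
      ρ.form (ρ.act e v) u = ∑ i, ρ.form (ρ.act (q i) v) v * (μ i + r)⁻¹ := by
    intro k x μ q hq hμ r hr
    refine ⟨ρ.act (∑ i, (μ i + r)⁻¹ • q i) v, ?_, ?_⟩
    · rw [← Module.End.mul_apply,
        ρ.act_mul_act_inv (hq.add_smul_e r) fun i => by have := hμ i; positivity]
    · rw [ρ.form_act, ← Module.End.mul_apply, ρ.act_e_mul, ρ.form_comm]
      simp [LinearMap.sum_apply, mul_comm]
  have hsum : ∀ {k : ℕ} {x : V} {μ : Fin k → ℝ} {q : Fin k → V} (_ : IsSpectralDecomposition x μ q),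
      ∑ i, ρ.form (ρ.act (q i) v) v = ρ.form (ρ.act e v) v := by
    intro k x μ q hq
    simp [← hq.complete, LinearMap.sum_apply]
  have key := log_sum_le (c := fun i => ρ.form (ρ.act (q i) v) v)
    (d := fun i => ρ.form (ρ.act (q' i) v) v) (b := fun i => ρ.form (ρ.act (q'' i) v) v)
    hμ hν hκ (t := t) (by rw [hsum hq, hsum hq'']) (by rw [hsum hq', hsum hq'']) (by
      intro r hr
      obtain ⟨u, hu, hu2⟩ := hres hq hμ hr
      obtain ⟨u', hu', hu2'⟩ := hres hq' hν hr
      obtain ⟨w, hw, hw2⟩ := hres hq'' hκ hr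
      rw [← hu2, ← hu2', ← hw2]
      exact ρ.concave_inverse ha (ρ.smul_mem (interior_subset ρ.e_mem_interior) hr)
        hα hβ hγ ht ht' h hu hu' hw)
  rw [hq.ln_eq, hq'.ln_eq, hq''.ln_eq]
  simp only [map_sub, map_add, map_smul, map_sum, LinearMap.sub_apply, LinearMap.add_apply,
    LinearMap.smul_apply, LinearMap.sum_apply, smul_eq_mul]
  simp only [mul_comm (ρ.form _ _)] at key
  linarith

/-- If the gradient of `F` is `∑ α_j a_j` with `a_j` in the cone and `1 / α_j` positive and concave,
then `ln ∇F` is convex for the order of the cone. -/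
theorem logConvex_of_grad (ρ : SymRep V E) {F : V → ℝ} {s : Finset J} {a : J → V} {α : V → J → ℝ}
    (ha : ∀ j ∈ s, a j ∈ coneOfSquares V)
    (hF : ∀ x ∈ interior (coneOfSquares V), DifferentiableAt ℝ F x ∧
      grad F x = ∑ j ∈ s, α x j • a j)
    (hi : ∀ x ∈ interior (coneOfSquares V), ∑ j ∈ s, α x j • a j ∈ interior (coneOfSquares V))
    (hα : ∀ x ∈ interior (coneOfSquares V), ∀ j ∈ s, 0 < α x j)
    (hconc : ∀ j ∈ s, ConcaveOn ℝ (interior (coneOfSquares V)) fun x => 1 / α x j) :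
    (∀ u ∈ coneOfSquares V, ConvexOn ℝ (interior (coneOfSquares V)) (phi F u)) ∧
      GradientLogConvex F := by
  have hconv : Convex ℝ (interior (coneOfSquares V)) := ρ.convex_coneOfSquares.interior
  have key : ∀ x ∈ interior (coneOfSquares V), ∀ y ∈ interior (coneOfSquares V),
      ∀ t : ℝ, 0 ≤ t → t ≤ 1 →
      t • ln (grad F x) + (1 - t) • ln (grad F y) - ln (grad F (t • x + (1 - t) • y))
        ∈ coneOfSquares V := by
    intro x hx y hy t ht ht'
    have hz := hconv hx hy ht (sub_nonneg.2 ht') (by ring)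
    rw [(hF x hx).2, (hF y hy).2, (hF _ hz).2]
    refine ρ.ln_combination_mem ha (hα x hx) (hα y hy) (hα _ hz) ht ht' (fun j hj => ?_)
      (hi x hx) (hi y hy) (hi _ hz)
    simpa [div_eq_mul_inv] using (hconc j hj).2 hx hy ht (sub_nonneg.2 ht') (by ring)
  refine ⟨fun u hu => ⟨hconv, fun x hx y hy t t' ht ht' htt' => ?_⟩, fun x hx => ⟨(hF x hx).1, ?_⟩,
    fun x hx y hy => key x (ρ.intrinsicInterior_simplex_subset hx) y
      (ρ.intrinsicInterior_simplex_subset hy)⟩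
  · obtain rfl : t' = 1 - t := by linarith
    have := ρ.inner_nonneg (key x hx y hy t ht (by linarith)) hu
    rw [inner_sub_left, inner_add_left, inner_smul_left, inner_smul_left] at this
    exact sub_nonneg.1 this
  · rw [(hF x hx).2]
    exact hi x hx

end SymRep

/-! ### Gradients of the two kinds of objective -/

section Gradient

variable {V : Type*} [NormedAddCommGroup V] [InnerProductSpace ℝ V]

theorem grad_eq_of_hasFDerivAt [FiniteDimensional ℝ V] {F : V → ℝ} {x g : V}
    (h : HasFDerivAt F (innerSL ℝ g) x) : DifferentiableAt ℝ F x ∧ grad F x = g := by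
  have : CompleteSpace V := FiniteDimensional.complete ℝ V
  exact ⟨h.differentiableAt, (hasGradientAt_iff_hasFDerivAt.2 h : HasGradientAt F g x).gradient⟩

theorem hasFDerivAt_inner_right (a x : V) :
    HasFDerivAt (fun x : V => inner ℝ x a) (innerSL ℝ a) x := by
  have h : (fun x : V => inner ℝ x a) = innerSL ℝ a := funext fun x => real_inner_comm a x
  exact h ▸ (innerSL ℝ a).hasFDerivAt

variable {J : Type*}

theorem hasFDerivAt_sum_log (s : Finset J) (w : J → ℝ) (a : J → V) {x : V}
    (hx : ∀ j ∈ s, inner ℝ x (a j) ≠ 0) :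
    HasFDerivAt (fun x => ∑ j ∈ s, w j * Real.log (inner ℝ x (a j)))
      (innerSL ℝ (∑ j ∈ s, (w j / inner ℝ x (a j)) • a j)) x := by
  have h := HasFDerivAt.fun_sum fun j (hj : j ∈ s) =>
    ((hasFDerivAt_inner_right (a j) x).log (hx j hj)).const_mul (w j)
  refine h.congr_fderiv ?_
  simp [div_eq_mul_inv, mul_smul]

theorem hasFDerivAt_log_sum_rpow (s : Finset J) {p : ℝ} (hp : p ≠ 0) (a : J → V) {x : V}
    (hx : ∀ j ∈ s, 0 < inner ℝ x (a j)) :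
    HasFDerivAt (fun x => p⁻¹ * Real.log (∑ j ∈ s, inner ℝ x (a j) ^ p))
      (innerSL ℝ (∑ j ∈ s, (inner ℝ x (a j) ^ (p - 1) / ∑ i ∈ s, inner ℝ x (a i) ^ p) • a j)) x := by
  -- For `s = ∅` the function is `p⁻¹ * log 0 = 0`, constant.
  rcases s.eq_empty_or_nonempty with rfl | hs
  · simpa using hasFDerivAt_const (0 : ℝ) x
  have hS : 0 < ∑ i ∈ s, inner ℝ x (a i) ^ p :=
    Finset.sum_pos (fun j hj => Real.rpow_pos_of_pos (hx j hj) p) hs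
  have h := HasFDerivAt.fun_sum fun j (hj : j ∈ s) =>
    (hasFDerivAt_inner_right (a j) x).rpow_const (p := p) (Or.inl (hx j hj).ne')
  refine ((h.log hS.ne').const_mul p⁻¹).congr_fderiv ?_
  simp only [map_sum, map_smul, Finset.smul_sum, smul_smul]
  refine Finset.sum_congr rfl fun j _ => ?_
  congr 1
  field_simp

end Gradient

/-- Joint concavity of the weighted geometric mean. -/
theorem rpow_mul_rpow_concave {p : ℝ} (hp : 0 < p) (hp' : p < 1) {x y x' y' t t' : ℝ} (hx : 0 < x)
    (hy : 0 < y) (hx' : 0 < x') (hy' : 0 < y') (ht : 0 ≤ t) (ht' : 0 ≤ t') (htt' : t + t' = 1) :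
    t * (x ^ p * y ^ (1 - p)) + t' * (x' ^ p * y' ^ (1 - p)) ≤
      (t * x + t' * x') ^ p * (t * y + t' * y') ^ (1 - p) := by
  have hconv : Convex ℝ (Set.Ioi (0 : ℝ)) := convex_Ioi 0
  have hX : 0 < t * x + t' * x' := hconv hx hx' ht ht' htt'
  have hY : 0 < t * y + t' * y' := hconv hy hy' ht ht' htt'
  set X := t * x + t' * x' with hXd
  set Y := t * y + t' * y' with hYd
  have key : ∀ {u v : ℝ}, 0 < u → 0 < v →
      u ^ p * v ^ (1 - p) ≤ (p * (u / X) + (1 - p) * (v / Y)) * (X ^ p * Y ^ (1 - p)) := by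
    intro u v hu hv
    have := Real.geom_mean_le_arith_mean2_weighted hp.le (sub_nonneg.2 hp'.le)
      (div_pos hu hX).le (div_pos hv hY).le (by ring)
    rw [Real.div_rpow hu.le hX.le, Real.div_rpow hv.le hY.le, div_mul_div_comm,
      div_le_iff₀ (by positivity)] at this
    exact this
  have h1 := mul_le_mul_of_nonneg_left (key hx hy) ht
  have h2 := mul_le_mul_of_nonneg_left (key hx' hy') ht'
  refine (add_le_add h1 h2).trans_eq ?_
  have h3 : t * (p * (x / X) + (1 - p) * (y / Y)) +
      t' * (p * (x' / X) + (1 - p) * (y' / Y)) = 1 := by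
    calc _ = p * ((t * x + t' * x') / X) + (1 - p) * ((t * y + t' * y') / Y) := by ring
      _ = 1 := by rw [← hXd, ← hYd, div_self hX.ne', div_self hY.ne']; ring
  rw [← mul_assoc t, ← mul_assoc t', ← add_mul, h3, one_mul]

namespace SymRep

variable {V E : Type*} [NormedAddCommGroup V] [InnerProductSpace ℝ V] [FiniteDimensional ℝ V]
  [JordanAlgebra V] [AssociativeInner V] [AddCommGroup E] [Module ℝ E] {J : Type*}

/-- Here `∇F(x) = ∑ α_j a_j` with `1 / α_j = ⟨x, a_j⟩ / w_j` linear in `x`. -/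
theorem logConvex_sum_log (ρ : SymRep V E) {s : Finset J} {a : J → V}
    (ha : ∀ j ∈ s, a j ∈ coneOfSquares V)
    (hpos : ∀ x ∈ interior (coneOfSquares V), ∀ j ∈ s, 0 < inner ℝ x (a j))
    (hint : ∀ α : J → ℝ, (∀ j ∈ s, 0 < α j) →
      ∑ j ∈ s, α j • a j ∈ interior (coneOfSquares V)) {w : J → ℝ} (hw : ∀ j ∈ s, 0 < w j) :
    (∀ u ∈ coneOfSquares V, ConvexOn ℝ (interior (coneOfSquares V))
      (phi (fun x => ∑ j ∈ s, w j * Real.log (inner ℝ x (a j))) u)) ∧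
      GradientLogConvex fun x : V => ∑ j ∈ s, w j * Real.log (inner ℝ x (a j)) := by
  have hα : ∀ x ∈ interior (coneOfSquares V), ∀ j ∈ s, 0 < w j / inner ℝ x (a j) :=
    fun x hx j hj => div_pos (hw j hj) (hpos x hx j hj)
  refine ρ.logConvex_of_grad ha (fun x hx => grad_eq_of_hasFDerivAt
    (hasFDerivAt_sum_log s w a fun j hj => (hpos x hx j hj).ne'))
    (fun x hx => hint _ (hα x hx)) hα fun j hj =>
      ⟨ρ.convex_coneOfSquares.interior, fun x _ y _ t t' _ _ _ => le_of_eq ?_⟩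
  simp only [one_div_div, inner_add_left, inner_smul_left, smul_eq_mul, conj_trivial]
  ring

/-- Here `∇F(x) = ∑ α_j a_j` with `1 / α_j = ∑ i, ⟨x, a_i⟩ ^ p * ⟨x, a_j⟩ ^ (1 - p)`, a sum of
weighted geometric means of positive linear functions of `x`. -/
theorem logConvex_log_sum_rpow (ρ : SymRep V E) {s : Finset J} {a : J → V}
    (ha : ∀ j ∈ s, a j ∈ coneOfSquares V)
    (hpos : ∀ x ∈ interior (coneOfSquares V), ∀ j ∈ s, 0 < inner ℝ x (a j))
    (hint : ∀ α : J → ℝ, (∀ j ∈ s, 0 < α j) →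
      ∑ j ∈ s, α j • a j ∈ interior (coneOfSquares V)) {p : ℝ} (hp : 0 < p) (hp' : p < 1) :
    (∀ u ∈ coneOfSquares V, ConvexOn ℝ (interior (coneOfSquares V))
      (phi (fun x => p⁻¹ * Real.log (∑ j ∈ s, inner ℝ x (a j) ^ p)) u)) ∧
      GradientLogConvex fun x : V => p⁻¹ * Real.log (∑ j ∈ s, inner ℝ x (a j) ^ p) := by
  have hconv : Convex ℝ (interior (coneOfSquares V)) := ρ.convex_coneOfSquares.interior
  have hα : ∀ x ∈ interior (coneOfSquares V), ∀ j ∈ s,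
      0 < inner ℝ x (a j) ^ (p - 1) / ∑ i ∈ s, inner ℝ x (a i) ^ p := fun x hx j hj =>
    div_pos (Real.rpow_pos_of_pos (hpos x hx j hj) _)
      (Finset.sum_pos (fun i hi => Real.rpow_pos_of_pos (hpos x hx i hi) p) ⟨j, hj⟩)
  have hinv : ∀ x ∈ interior (coneOfSquares V), ∀ j ∈ s,
      1 / (inner ℝ x (a j) ^ (p - 1) / ∑ i ∈ s, inner ℝ x (a i) ^ p) =
        ∑ i ∈ s, inner ℝ x (a i) ^ p * inner ℝ x (a j) ^ (1 - p) := fun x hx j hj => by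
    rw [one_div_div, ← Finset.sum_mul, ← neg_sub p 1, Real.rpow_neg (hpos x hx j hj).le,
      div_eq_mul_inv]
  refine ρ.logConvex_of_grad ha (fun x hx => grad_eq_of_hasFDerivAt
    (hasFDerivAt_log_sum_rpow s hp.ne' a (hpos x hx)))
    (fun x hx => hint _ (hα x hx)) hα fun j hj =>
      ⟨hconv, fun x hx y hy t t' ht ht' htt' => ?_⟩
  beta_reduce
  rw [hinv x hx j hj, hinv y hy j hj, hinv _ (hconv hx hy ht ht' htt') j hj]
  simp only [smul_eq_mul, Finset.mul_sum, ← Finset.sum_add_distrib, inner_add_left,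
    inner_smul_left, conj_trivial]
  exact Finset.sum_le_sum fun i hi => rpow_mul_rpow_concave hp hp' (hpos x hx i hi)
    (hpos x hx j hj) (hpos y hy i hi) (hpos y hy j hj) ht ht' htt'

theorem logConvex_of_isAdmissible (ρ : SymRep V E) {m : ℕ} {T : V →ₗ[ℝ] EuclideanSpace ℝ (Fin m)}
    (hT : IsAdmissible T) :
    (∀ w : Fin m → ℝ, (∀ j, 0 < w j) →
      (∀ u ∈ coneOfSquares V, ConvexOn ℝ (interior (coneOfSquares V))
        (phi (fun x => sumLogs w (T x)) u)) ∧ GradientLogConvex fun x => sumLogs w (T x)) ∧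
    ∀ p : ℝ, 0 < p → p < 1 →
      (∀ u ∈ coneOfSquares V, ConvexOn ℝ (interior (coneOfSquares V))
        (phi (fun x => logPNorm p (T x)) u)) ∧ GradientLogConvex fun x => logPNorm p (T x) := by
  let a : Fin m → V := fun j => LinearMap.adjoint T (EuclideanSpace.single j 1)
  have hTa : ∀ x j, T x j = inner ℝ x (a j) := fun x j => by
    rw [LinearMap.adjoint_inner_right, EuclideanSpace.inner_single_right]
    simp
  have hsum : ∀ α : Fin m → ℝ, ∑ j, α j • a j = LinearMap.adjoint T (WithLp.toLp 2 α) := fun α => by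
    simp only [a, ← map_smul, ← map_sum]
    congr 1
    ext i
    simp [Pi.single_apply]
  have hint : ∀ α : Fin m → ℝ, (∀ j, 0 < α j) →
      ∑ j, α j • a j ∈ interior (coneOfSquares V) := fun α hα => by
    rw [hsum]
    exact hT.2 _ hα
  -- `a j` is only a limit of images of the open orthant.
  have ha : ∀ j, a j ∈ coneOfSquares V := fun j => by
    have hlim : Tendsto (fun ε : ℝ => a j + ε • ∑ i, a i) (𝓝[>] 0) (𝓝 (a j)) := by
      have : Tendsto (fun ε : ℝ => a j + ε • ∑ i, a i) (𝓝 0) (𝓝 (a j + (0 : ℝ) • ∑ i, a i)) :=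
        Continuous.tendsto (by fun_prop) 0
      rw [zero_smul, add_zero] at this
      exact this.mono_left nhdsWithin_le_nhds
    refine ρ.isClosed_coneOfSquares.mem_of_tendsto hlim ?_
    filter_upwards [self_mem_nhdsWithin] with ε hε
    have := hint (fun i => (if i = j then 1 else 0) + ε) fun i => by
      have : (0 : ℝ) < ε := hε
      split_ifs <;> positivity
    simp only [add_smul, Finset.sum_add_distrib, ite_smul, one_smul, zero_smul, Finset.sum_ite_eq',
      Finset.mem_univ, if_true, ← Finset.smul_sum] at this
    exact interior_subset this
  have hpos : ∀ x ∈ interior (coneOfSquares V), ∀ j, 0 < inner ℝ x (a j) := fun x hx j => by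
    rw [← hTa]
    exact hT.1 x hx j
  simp only [sumLogs, logPNorm, hTa]
  exact ⟨fun w hw => ρ.logConvex_sum_log (fun j _ => ha j) (fun x hx j _ => hpos x hx j)
      (fun α hα => hint α fun j => hα j (Finset.mem_univ j)) fun j _ => hw j,
    fun p hp hp' => ρ.logConvex_log_sum_rpow (fun j _ => ha j) (fun x hx j _ => hpos x hx j)
      (fun α hα => hint α fun j => hα j (Finset.mem_univ j)) hp hp'⟩

end SymRep

/-! ### Representable algebras have a symmetric representation -/

section Associative

variable {A : Type*} [Ring A] [Algebra ℝ A] [StarRing A] [StarModule ℝ A]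

theorem isSelfAdjoint_aeval {s : A} (hs : IsSelfAdjoint s) (p : Polynomial ℝ) :
    IsSelfAdjoint (Polynomial.aeval s p) := by
  rw [Polynomial.aeval_eq_sum_range]
  refine isSelfAdjoint_sum _ fun i _ => ?_
  exact IsSelfAdjoint.smul (.all _) (hs.pow i)

/-- A symmetric element with `s² = 0` vanishes since `B(s, s) = B(s², e)`; higher powers are reduced
to this by repeated squaring. -/
theorem eq_zero_of_isNilpotent (hA : IsEuclidean (Sym A)) {s : A} (hs : IsSelfAdjoint s)
    (hn : IsNilpotent s) : s = 0 := by
  obtain ⟨B, -, hpos, hassoc⟩ := hA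
  have hsq : ∀ s : A, IsSelfAdjoint s → s * s = 0 → s = 0 := fun s hs h => by
    by_contra h0
    let x : Sym A := ⟨s, hs⟩
    have hx : jmul x x = 0 := Subtype.ext <| by
      change (2⁻¹ : ℝ) • (s * s + s * s) = 0
      rw [h, add_zero, smul_zero]
    have := hpos x fun h => h0 (congrArg Subtype.val h)
    have h2 := hassoc x x e
    rw [jmul_comm x e, e_jmul, hx, map_zero, LinearMap.zero_apply] at h2
    exact this.ne' h2
  obtain ⟨n, hn⟩ := hn
  have h2n : s ^ 2 ^ n = 0 := pow_eq_zero_of_le Nat.lt_two_pow_self.le hn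
  clear hn
  induction n with
  | zero => simpa using h2n
  | succ n ih =>
    refine ih (hsq _ (hs.pow _) ?_)
    rw [← pow_add, ← two_mul, ← pow_succ']
    exact h2n

/-- Symmetric elements are von Neumann regular in the algebra they generate. With the minimal
polynomial written as `X ^ k * g`, `g(0) ≠ 0`, the element `s g(s)` is nilpotent, hence zero. -/
theorem exists_aeval_mul_self [FiniteDimensional ℝ A] (hA : IsEuclidean (Sym A)) {s : A}
    (hs : IsSelfAdjoint s) : ∃ p : Polynomial ℝ, s * s * Polynomial.aeval s p = s := by
  have hm : minpoly ℝ s ≠ 0 := minpoly.ne_zero (Algebra.IsIntegral.isIntegral s)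
  obtain ⟨g, hg, hdvd⟩ := Polynomial.exists_eq_pow_rootMultiplicity_mul_and_not_dvd _ hm 0
  rw [Polynomial.C_0, sub_zero] at hg hdvd
  have hc : g.coeff 0 ≠ 0 := fun h => hdvd (Polynomial.X_dvd_iff.2 h)
  set k := (minpoly ℝ s).rootMultiplicity 0
  have hcomm : Commute s (Polynomial.aeval s g) := by
    have := congrArg (Polynomial.aeval s) (mul_comm Polynomial.X g)
    rwa [map_mul, map_mul, Polynomial.aeval_X] at this
  have hz : s ^ k * Polynomial.aeval s g = 0 := by
    have := congrArg (Polynomial.aeval s) hg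
    simpa using this.symm
  have hnil : s * Polynomial.aeval s g = 0 := by
    have hself : IsSelfAdjoint (s * Polynomial.aeval s g) := by
      have := isSelfAdjoint_aeval hs (Polynomial.X * g)
      rwa [map_mul, Polynomial.aeval_X] at this
    refine eq_zero_of_isNilpotent hA hself ⟨k + 1, ?_⟩
    rw [hcomm.mul_pow, pow_succ', pow_succ', mul_assoc, ← mul_assoc (s ^ k), hz, zero_mul,
      mul_zero]
  refine ⟨Polynomial.C (-(g.coeff 0)⁻¹) * g.divX, ?_⟩
  have hgs : s * (s * Polynomial.aeval s g.divX) = -(g.coeff 0 • s) := by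
    rw [eq_neg_iff_add_eq_zero, ← hnil]
    conv_rhs => rw [← Polynomial.X_mul_divX_add g, map_add, map_mul, Polynomial.aeval_X,
      Polynomial.aeval_C, mul_add, ← Algebra.commutes, ← Algebra.smul_def]
  rw [map_mul, Polynomial.aeval_C, ← Algebra.smul_def, mul_smul_comm, mul_assoc, hgs, smul_neg,
    neg_smul, neg_neg, smul_smul, inv_mul_cancel₀ hc, one_smul]

/-- The trace of left multiplication by an element of a possibly noncommutative algebra. -/
noncomputable def leftTrace (A : Type*) [Ring A] [Algebra ℝ A] : A →ₗ[ℝ] ℝ :=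
  LinearMap.trace ℝ A ∘ₗ (Algebra.lmul ℝ A).toLinearMap

theorem leftTrace_mul_comm {A : Type*} [Ring A] [Algebra ℝ A] (x y : A) :
    leftTrace A (x * y) = leftTrace A (y * x) := by
  change LinearMap.trace ℝ A (Algebra.lmul ℝ A _) = LinearMap.trace ℝ A (Algebra.lmul ℝ A _)
  rw [map_mul (Algebra.lmul ℝ A), map_mul (Algebra.lmul ℝ A), LinearMap.trace_mul_comm]

/-- The symmetrized trace form `tr(x y') + tr(y x')`. The trace of left multiplication need not be
invariant under the conjugation, so that `tr(x y')` alone need not be symmetric. -/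
noncomputable def traceForm (A : Type*) [Ring A] [Algebra ℝ A] [StarRing A] [StarModule ℝ A] :
    A →ₗ[ℝ] A →ₗ[ℝ] ℝ :=
  LinearMap.mk₂ ℝ (fun x y => leftTrace A (x * star y) + leftTrace A (y * star x))
    (fun x y z => by simp only [star_add, add_mul, mul_add, map_add]; ring)
    (fun c x y => by simp [star_smul]; ring)
    (fun x y z => by simp only [star_add, add_mul, mul_add, map_add]; ring)
    (fun c x y => by simp [star_smul]; ring)

theorem traceForm_apply (x y : A) : traceForm A x y =
    leftTrace A (x * star y) + leftTrace A (y * star x) := rfl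

/-- A null vector `s` of the form is orthogonal to all elements, and so the idempotent `s r` in the
algebra generated by `s` with `s = s (s r)` has trace zero, that is, rank zero. -/
theorem eq_zero_of_traceForm_eq_zero [FiniteDimensional ℝ A] (hA : IsEuclidean (Sym A))
    (hpos : ∀ x : A, 0 ≤ traceForm A x x) {s : A} (hs : IsSelfAdjoint s)
    (h : traceForm A s s = 0) : s = 0 := by
  obtain ⟨p, hp⟩ := exists_aeval_mul_self hA hs
  set r := Polynomial.aeval s p with hr
  have hrs : IsSelfAdjoint r := isSelfAdjoint_aeval hs p
  have hcomm : s * r = r * s := by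
    have := congrArg (Polynomial.aeval s) (mul_comm Polynomial.X p)
    rwa [map_mul, map_mul, Polynomial.aeval_X] at this
  have hsymm : traceForm A r s = traceForm A s r := by
    rw [traceForm_apply, traceForm_apply, add_comm]
  -- Cauchy–Schwarz for the semidefinite form
  have hzero : traceForm A s r = 0 := by
    have hq : ∀ c : ℝ, 0 ≤ 0 * (c * c) + 2 * traceForm A s r * c + traceForm A r r := fun c => by
      have := hpos (c • s + r)
      simp only [map_add, map_smul, LinearMap.add_apply, LinearMap.smul_apply, smul_eq_mul, h,
        hsymm] at this
      linarith
    have := discrim_le_zero hq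
    rw [discrim] at this
    nlinarith
  have htr : leftTrace A (s * r) = 0 := by
    rw [traceForm_apply, hrs.star_eq, hs.star_eq, ← hcomm] at hzero
    linarith
  have hidem : IsIdempotentElem (s * r) := by
    rw [IsIdempotentElem, ← mul_assoc, mul_assoc s r s, ← hcomm, ← mul_assoc s s r, hp]
  have hL : IsIdempotentElem (Algebra.lmul ℝ A (s * r)) := hidem.map _
  have hL0 := LinearMap.IsIdempotentElem.eq_zero_of_trace_eq_zero hL htr
  have hsr : s * r = 0 := by simpa using LinearMap.congr_fun hL0 1
  rw [← hp, mul_assoc, hsr, mul_zero]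

end Associative

/-- The symmetric elements act on the associative algebra by left multiplication, symmetrically for
the trace form. -/
theorem IsRepresentable.exists_symRep {V : Type*} [AddCommGroup V] [Module ℝ V] [JordanAlgebra V]
    (h : IsRepresentable V) :
    ∃ (A : Type) (_ : AddCommGroup A) (_ : Module ℝ A), Nonempty (SymRep V A) := by
  obtain ⟨A, _, _, _, _, hfin, htr, hA, ι, hι, hmul⟩ := h
  have hpos : ∀ x : A, 0 ≤ traceForm A x x := fun x => add_nonneg (htr x) (htr x)
  have hs : ∀ x, IsSelfAdjoint (ι x : A) := fun x => (ι x).2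
  refine ⟨A, inferInstance, inferInstance, ⟨{
    form := traceForm A
    act := (Algebra.lmul ℝ A).toLinearMap ∘ₗ (selfAdjoint.submodule ℝ A).subtype ∘ₗ ι
    form_comm := fun v w => by rw [traceForm_apply, traceForm_apply, add_comm]
    form_nonneg := hpos
    act_jmul := fun x y => ?_
    form_act := fun x v w => ?_
    faithful := fun x hx => ?_ }⟩⟩
  · simp only [LinearMap.comp_apply, hmul]
    change Algebra.lmul ℝ A ((2⁻¹ : ℝ) • ((ι x : A) * ι y + ι y * ι x)) = _
    rw [map_smul, map_add, map_mul, map_mul]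
    rfl
  · change traceForm A ((ι x : A) * v) w = traceForm A v ((ι x : A) * w)
    simp only [traceForm_apply, star_mul, (hs x).star_eq]
    rw [mul_assoc, leftTrace_mul_comm, mul_assoc, ← mul_assoc w,
      leftTrace_mul_comm (w * star v), mul_assoc (ι x : A)]
  · have := eq_zero_of_traceForm_eq_zero hA hpos (hs x) (by
      have := hx 1
      change traceForm A ((ι x : A) * 1) ((ι x : A) * 1) = 0 at this
      rwa [mul_one] at this)
    exact hι (Subtype.ext (by rw [map_zero]; exact this))

/-! ### Hermitian matrices -/

namespace Herm

variable {n : ℕ} {𝕜 : Type} [RCLike 𝕜]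

variable (n 𝕜) in
/-- Hermitian matrices acting on column vectors, with the form `Re ⟨v, w⟩`. The column space `𝕜ⁿ` is
regarded as a real vector space, so that `𝕜 = ℝ` and `𝕜 = ℂ` are treated alike. -/
noncomputable def symRep : SymRep (Herm n 𝕜) (Fin n → 𝕜) where
  form := LinearMap.mk₂ ℝ (fun v w => RCLike.re (star v ⬝ᵥ w))
    (fun v v' w => by rw [star_add, add_dotProduct, map_add])
    (fun c v w => by rw [star_smul, smul_dotProduct, star_trivial, RCLike.smul_re, smul_eq_mul])
    (fun v w w' => by rw [dotProduct_add, map_add])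
    (fun c v w => by rw [dotProduct_smul, RCLike.smul_re, smul_eq_mul])
  act :=
    { toFun := fun X => (Matrix.mulVecLin X.mat).restrictScalars ℝ
      map_add' := fun X Y => LinearMap.ext fun v => add_mulVec X.mat Y.mat v
      map_smul' := fun c X => LinearMap.ext fun v => smul_mulVec c X.mat v }
  form_comm v w := by
    rw [LinearMap.mk₂_apply, LinearMap.mk₂_apply, ← RCLike.conj_re, ← RCLike.star_def,
      star_dotProduct, star_star]
  form_nonneg v := (RCLike.nonneg_iff.1 (dotProduct_star_self_nonneg v)).1
  act_jmul X Y := LinearMap.ext fun v => by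
    change ((2⁻¹ : ℝ) • (X.mat * Y.mat + Y.mat * X.mat)) *ᵥ v =
      (2⁻¹ : ℝ) • (X.mat *ᵥ (Y.mat *ᵥ v) + Y.mat *ᵥ (X.mat *ᵥ v))
    rw [smul_mulVec, add_mulVec, mulVec_mulVec, mulVec_mulVec]
  form_act X v w := by
    change RCLike.re (star (X.mat *ᵥ v) ⬝ᵥ w) = RCLike.re (star v ⬝ᵥ (X.mat *ᵥ w))
    rw [star_mulVec, X.star_mat, dotProduct_mulVec]
  faithful X hX := by
    have h : ∀ v, X.mat *ᵥ v = 0 := fun v => by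
      by_contra hv
      exact (RCLike.pos_iff.1 (dotProduct_star_self_pos_iff.2 hv)).1.ne' (hX v)
    exact Subtype.ext (Matrix.ext_of_mulVec_single fun i => by
      exact (h _).trans (zero_mulVec _).symm)

theorem form_symRep (v w : Fin n → 𝕜) : (symRep n 𝕜).form v w = RCLike.re (star v ⬝ᵥ w) := rfl

theorem act_symRep (X : Herm n 𝕜) (v : Fin n → 𝕜) : (symRep n 𝕜).act X v = X.mat *ᵥ v := rfl

theorem form_symRep_pos {v : Fin n → 𝕜} (hv : v ≠ 0) : 0 < (symRep n 𝕜).form v v := by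
  rw [form_symRep]
  exact (RCLike.pos_iff.1 (dotProduct_star_self_pos_iff.2 hv)).1

theorem mat_rankOne (a : Fin n → 𝕜) : (rankOne a).mat = vecMulVec a (star a) := rfl

theorem form_rankOne (a v : Fin n → 𝕜) :
    (symRep n 𝕜).form ((symRep n 𝕜).act (rankOne a) v) v = ‖star a ⬝ᵥ v‖ ^ 2 := by
  rw [(symRep n 𝕜).form_act, form_symRep, act_symRep, mat_rankOne, vecMulVec_mulVec,
    op_smul_eq_smul, dotProduct_smul, smul_eq_mul, star_dotProduct v, mul_comm, RCLike.star_def,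
    RCLike.conj_mul]
  norm_cast

theorem inner_rankOne (X : Herm n 𝕜) (a : Fin n → 𝕜) :
    inner ℝ X (rankOne a) = (symRep n 𝕜).form ((symRep n 𝕜).act X a) a := by
  rw [(symRep n 𝕜).form_act, form_symRep, act_symRep, inner_def, mat_rankOne, mul_vecMulVec,
    trace_vecMulVec, dotProduct_comm]

theorem rankOne_mem (a : Fin n → 𝕜) : rankOne a ∈ coneOfSquares (Herm n 𝕜) := by
  rw [(symRep n 𝕜).mem_coneOfSquares_iff]
  intro v
  rw [form_rankOne]
  positivity

theorem inner_rankOne_pos {X : Herm n 𝕜} (hX : X ∈ interior (coneOfSquares (Herm n 𝕜)))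
    {a : Fin n → 𝕜} (ha : a ≠ 0) : 0 < inner ℝ X (rankOne a) := by
  obtain ⟨ε, hε, h⟩ := SymRep.exists_sub_smul_mem (z := e) hX
  have h1 := (symRep n 𝕜).form_nonneg_of_mem h a
  have h2 : (symRep n 𝕜).act e a = a := one_mulVec a
  rw [map_sub, map_smul, LinearMap.sub_apply, LinearMap.smul_apply, map_sub, map_smul,
    LinearMap.sub_apply, LinearMap.smul_apply, h2, ← inner_rankOne, smul_eq_mul] at h1
  have h3 := mul_pos hε (form_symRep_pos ha)
  linarith

/-- If the vectors `a j` span, positive combinations of the matrices `a_j a_j^H` are positive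
definite. -/
theorem sum_rankOne_mem_interior {J : Type*} {s : Finset J} {a : J → Fin n → 𝕜}
    (ha : ∀ v, (∀ j ∈ s, star (a j) ⬝ᵥ v = 0) → v = 0) {α : J → ℝ} (hα : ∀ j ∈ s, 0 < α j) :
    ∑ j ∈ s, α j • rankOne (a j) ∈ interior (coneOfSquares (Herm n 𝕜)) := by
  refine (symRep n 𝕜).mem_interior_of_form_pos fun v hv => ?_
  have hv0 : v ≠ 0 := by
    rintro rfl
    simp at hv
  have hex : ∃ j ∈ s, star (a j) ⬝ᵥ v ≠ 0 := by
    by_contra! h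
    exact hv0 (ha v h)
  simp only [map_sum, map_smul, LinearMap.sum_apply, LinearMap.smul_apply, form_rankOne,
    smul_eq_mul]
  obtain ⟨j, hj, hne⟩ := hex
  exact Finset.sum_pos' (fun i hi => mul_nonneg (hα i hi).le (sq_nonneg _))
    ⟨j, hj, mul_pos (hα j hj) (pow_pos (norm_pos_iff.2 hne) 2)⟩

end Herm

theorem logConvex_qstObjective {n m : ℕ} {c : Fin m → ℕ} {a : Fin m → Fin n → ℂ}
    (ha : ∀ j, 0 < c j → a j ≠ 0)
    (hpd : (∑ j with 0 < c j, vecMulVec (a j) (star (a j))).PosDef) :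
    (∀ u ∈ coneOfSquares (Herm n ℂ), ConvexOn ℝ (interior (coneOfSquares (Herm n ℂ)))
      (phi (qstObjective c a) u)) ∧ GradientLogConvex (qstObjective c a) := by
  -- Channels with count zero contribute nothing and may have `a j = 0`; they are left out.
  let s : Finset (Fin m) := Finset.univ.filter fun j => 0 < c j
  have hs : ∀ j ∈ s, 0 < c j := fun j hj => (Finset.mem_filter.1 hj).2
  have hF : qstObjective c a = fun X => ∑ j ∈ s,
      ((∑ i, (c i : ℝ))⁻¹ * c j) * Real.log (inner ℝ X (rankOne (a j))) := by
    funext X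
    rw [qstObjective, Finset.mul_sum, Finset.sum_filter]
    refine Finset.sum_congr rfl fun j _ => ?_
    split_ifs with h
    · rw [mul_assoc]
    · simp [Nat.eq_zero_of_not_pos h]
  have hspan : ∀ v, (∀ j ∈ s, star (a j) ⬝ᵥ v = 0) → v = 0 := by
    intro v hv
    by_contra hv0
    refine (hpd.dotProduct_mulVec_pos hv0).ne' ?_
    rw [sum_mulVec, dotProduct_sum]
    refine Finset.sum_eq_zero fun j hj => ?_
    rw [vecMulVec_mulVec, hv j hj]
    simp
  rw [hF]
  refine (Herm.symRep n ℂ).logConvex_sum_log (fun j _ => Herm.rankOne_mem _)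
    (fun X hX j hj => Herm.inner_rankOne_pos hX (ha j (hs j hj)))
    (fun α hα => Herm.sum_rankOne_mem_interior hspan hα) fun j hj => ?_
  have hcj : (0 : ℝ) < c j := Nat.cast_pos.2 (hs j hj)
  exact mul_pos (inv_pos.2 (Finset.sum_pos' (fun i _ => Nat.cast_nonneg _)
    ⟨j, Finset.mem_univ j, hcj⟩)) hcj

theorem logConvex_bqpObjective {n : ℕ} {R : Matrix (Fin n) (Fin n) ℝ} (hR : IsUnit R) :
    (∀ u ∈ coneOfSquares (Herm n ℝ), ConvexOn ℝ (interior (coneOfSquares (Herm n ℝ)))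
      (phi (bqpObjective R) u)) ∧ GradientLogConvex (bqpObjective R) := by
  have hF : bqpObjective R = fun X : Herm n ℝ =>
      (1 / 2 : ℝ)⁻¹ * Real.log (∑ i, inner ℝ X (rankOne (R.col i)) ^ (1 / 2 : ℝ)) := by
    funext X
    simp only [bqpObjective, Real.sqrt_eq_rpow]
    norm_num
  have hcol : ∀ i, R.col i ≠ 0 := by
    intro i hi
    have h : R *ᵥ Pi.single i 1 = R *ᵥ 0 := by
      rw [mulVec_single_one, hi, mulVec_zero]
    have := congrFun (mulVec_injective_of_isUnit hR h) i
    simp at this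
  have hspan : ∀ v, (∀ i ∈ Finset.univ, star (R.col i) ⬝ᵥ v = 0) → v = 0 := by
    intro v hv
    refine mulVec_injective_of_isUnit ((isUnit_transpose R).2 hR) ?_
    rw [mulVec_zero]
    funext i
    have h := hv i (Finset.mem_univ i)
    rw [star_trivial] at h
    exact h
  rw [hF]
  exact (Herm.symRep n ℝ).logConvex_log_sum_rpow (fun i _ => Herm.rankOne_mem _)
    (fun X hX i _ => Herm.inner_rankOne_pos hX (hcol i))
    (fun α hα => Herm.sum_rankOne_mem_interior hspan hα) (by norm_num) (by norm_num)

end EJA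

theorem mainTheorem4 :
    (∀ (V : Type*) [NormedAddCommGroup V] [InnerProductSpace ℝ V] [FiniteDimensional ℝ V]
        [EJA.JordanAlgebra V] [EJA.AssociativeInner V], EJA.IsRepresentable V →
      ∀ (m : ℕ) (T : V →ₗ[ℝ] EuclideanSpace ℝ (Fin m)), EJA.IsAdmissible T →
        (∀ w : Fin m → ℝ, (∀ j, 0 < w j) → ∑ j, w j = 1 →
          (∀ u ∈ EJA.coneOfSquares V, ConvexOn ℝ (interior (EJA.coneOfSquares V))
            (EJA.phi (fun x => EJA.sumLogs w (T x)) u)) ∧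
          EJA.GradientLogConvex (fun x => EJA.sumLogs w (T x))) ∧
        (∀ p : ℝ, 0 < p → p < 1 →
          (∀ u ∈ EJA.coneOfSquares V, ConvexOn ℝ (interior (EJA.coneOfSquares V))
            (EJA.phi (fun x => EJA.logPNorm p (T x)) u)) ∧
          EJA.GradientLogConvex (fun x => EJA.logPNorm p (T x)))) ∧
    (∀ (n m : ℕ) (c : Fin m → ℕ) (a : Fin m → Fin n → ℂ), (∀ j, 0 < c j → a j ≠ 0) →
        (∑ j with 0 < c j, Matrix.vecMulVec (a j) (star (a j))).PosDef →
      (∀ u ∈ EJA.coneOfSquares (EJA.Herm n ℂ),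
        ConvexOn ℝ (interior (EJA.coneOfSquares (EJA.Herm n ℂ)))
          (EJA.phi (EJA.qstObjective c a) u)) ∧
      EJA.GradientLogConvex (EJA.qstObjective c a)) ∧
    (∀ (n : ℕ) (Q R : Matrix (Fin n) (Fin n) ℝ), Q.PosDef → R.PosSemidef → R * R = Q →
      (∀ u ∈ EJA.coneOfSquares (EJA.Herm n ℝ),
        ConvexOn ℝ (interior (EJA.coneOfSquares (EJA.Herm n ℝ)))
          (EJA.phi (EJA.bqpObjective R) u)) ∧
      EJA.GradientLogConvex (EJA.bqpObjective R)) := by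
  refine ⟨fun V _ _ _ _ _ hV m T hT => ?_, fun n m c a ha hpd => EJA.logConvex_qstObjective ha hpd,
    fun n Q R hQ _ hRQ => EJA.logConvex_bqpObjective ?_⟩
  · obtain ⟨A, _, _, ⟨ρ⟩⟩ := hV.exists_symRep
    exact ⟨fun w hw _ => (ρ.logConvex_of_isAdmissible hT).1 w hw,
      (ρ.logConvex_of_isAdmissible hT).2⟩
  · have h : IsUnit (R * R) := hRQ ▸ hQ.isUnit
    exact isUnit_of_mul_isUnit_left h
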